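/- Fix an integer $k>1$ and a real $\alpha\ge 1$. Let $V$ be a finite set with $|V|=km$. The complete $k$-uniform hypergraph on $V$ has as edges all $k$-subsets of $V$; a complete $k$-partite hypergraph on $V$ is given by a partition $V=V_1\cup\dots\cup V_k$ into parts of size $m$ and has as edges all sets $S\subset V$ with $|S\cap V_i|=1$ for every $i$. For a weight $Z=\{z_S: S\in H\}$ of real numbers on the edges of such a hypergraph $H$, let $P_H(Z)=\sum z_{S_1}\cdots z_{S_m}$, the sum being over all perfect matchings $\{S_1,\dots,S_m\}$ of $H$ (sets of pairwise disjoint edges with union $V$). The weight $Z$ is $k$-stochastic if $\sum_{S\in H,\,S\ni v} z_S=1$ for every $v\in V$, and $\alpha$-balanced if $z_S>0$ for all $S\in H$ and $z_{S}/z_{T}\le\alpha$ for all $S,T\in H$. (a) There is a real $\gamma=\gamma(k,\alpha)>0$ such that for every integer $m>1$, every set $V$ with $|V|=km$, every $H$ that is the complete $k$-uniform hypergraph or a complete $k$-partite hypergraph on $V$, and every $k$-stochastic $\alpha$-balanced weight $Z$ on $H$, $$m^{-\gamma}e^{-m(k-1)}\ \le\ P_H(Z)\ \le\ m^{\gamma}e^{-m(k-1)}.$$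 (b) If, in addition, $\alpha^{k+1}>2$, then for all such $m$, $V$, $H$ and $Z$, $$\epsilon_1 m^{-\gamma_1}e^{-m(k-1)}\ \le\ P_H(Z)\ \le\ \epsilon_2 m^{\gamma_2}e^{-m(k-1)},$$ where $l=\lceil\alpha^{2(k+1)}k^2\rceil+1$ and $$\gamma_1=\alpha^{3(k+1)}(k^2+k)^2+(k-1)^2,\quad \gamma_2=\frac{k^2\alpha^{k+1}}{2},\quad \epsilon_1=\alpha^{-(k+1)l}\,l^{\,l}\binom{kl}{k}^{1-l},\quad \epsilon_2=e^{(k-1)l}.$$ -/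

import Mathlib

universe u

namespace HypergraphMatching

/-- A hypergraph on the vertex type `V` is given by its finite set of edges `H`.
`H` is the complete `k`-uniform hypergraph if its edges are exactly the `k`-subsets of `V`. -/
def IsCompleteUniform {V : Type*} (k : ℕ) (H : Finset (Finset V)) : Prop :=
  ∀ S : Finset V, S ∈ H ↔ S.card = k

/-- `H` is a complete `k`-partite hypergraph with parts of size `m`: the vertex set is the union
of pairwise disjoint parts `V₁, …, V_k`, each of size `m`, and the edges are exactly the sets of
vertices that contain exactly one vertex of each part. -/
def IsCompletePartite {V : Type*} [DecidableEq V] (k m : ℕ) (H : Finset (Finset V)) : Prop :=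
  ∃ part : Fin k → Finset V,
    (∀ i j, i ≠ j → Disjoint (part i) (part j)) ∧
    (∀ v, ∃ i, v ∈ part i) ∧
    (∀ i, (part i).card = m) ∧
    ∀ S : Finset V, S ∈ H ↔ ∀ i, (S ∩ part i).card = 1

/-- A perfect matching of `H`: a set of pairwise disjoint edges whose union is the vertex set. -/
def IsPerfectMatching {V : Type*} (H M : Finset (Finset V)) : Prop :=
  M ⊆ H ∧ (∀ S ∈ M, ∀ T ∈ M, S ≠ T → Disjoint S T) ∧ ∀ v, ∃ S ∈ M, v ∈ S

/- A weight on `H` is a function `w : Finset V → ℝ` of which only the values at the edges of `H`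
are ever used. -/

open Classical in
/-- The partition function `P_H(W)`: the sum, over all perfect matchings of `H`, of the product
of the weights of the edges in the matching. -/
noncomputable def partitionFunction {V : Type*} (H : Finset (Finset V))
    (w : Finset V → ℝ) : ℝ :=
  ∑ M ∈ H.powerset with IsPerfectMatching H M, ∏ S ∈ M, w S

/-- The weight is positive and any two edge weights are within a factor of `α` of each other. -/
def IsBalanced {V : Type*} (α : ℝ) (H : Finset (Finset V)) (w : Finset V → ℝ) : Prop :=
  (∀ S ∈ H, 0 < w S) ∧ ∀ S ∈ H, ∀ T ∈ H, w S / w T ≤ α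

/-- For every vertex, the sum of the weights of the edges that contain the vertex is `1`. -/
def IsStochastic {V : Type*} [DecidableEq V] (H : Finset (Finset V))
    (w : Finset V → ℝ) : Prop :=
  ∀ v : V, ∑ S ∈ H with v ∈ S, w S = 1

/-- `l = ⌈α ^ (2 (k + 1)) k ^ 2⌉ + 1`. -/
noncomputable def ell (k : ℕ) (α : ℝ) : ℕ := ⌈α ^ (2 * (k + 1)) * (k : ℝ) ^ 2⌉₊ + 1

/-- `γ₁ = α ^ (3 (k + 1)) (k ^ 2 + k) ^ 2 + (k - 1) ^ 2`. -/
noncomputable def gammaLower (k : ℕ) (α : ℝ) : ℝ :=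
  α ^ (3 * (k + 1)) * ((k : ℝ) ^ 2 + k) ^ 2 + ((k : ℝ) - 1) ^ 2

/-- `γ₂ = k ^ 2 α ^ (k + 1) / 2`. -/
noncomputable def gammaUpper (k : ℕ) (α : ℝ) : ℝ := (k : ℝ) ^ 2 * α ^ (k + 1) / 2

/-- `ε₁ = α ^ (-(k + 1) l) l ^ l (kl choose k) ^ (1 - l)`. -/
noncomputable def epsLower (k : ℕ) (α : ℝ) : ℝ :=
  α ^ (-(((k : ℤ) + 1) * (ell k α : ℤ))) * (ell k α : ℝ) ^ ell k α *
    ((k * ell k α).choose k : ℝ) ^ (1 - (ell k α : ℤ))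

/-- `ε₂ = e ^ ((k - 1) l)`. -/
noncomputable def epsUpper (k : ℕ) (α : ℝ) : ℝ := Real.exp (((k : ℝ) - 1) * (ell k α : ℝ))

end HypergraphMatching

/-!
Every positive weight `w` on the edges inside a vertex set `U` of `k * j` vertices has a scaling:
multipliers `λ_v > 0` such that `x_T = w_T ∏_{v ∈ T} λ_v` has all vertex sums equal to `1`
(`Homogeneous.exists_isScaling`). Scaling multiplies the partition function by `∏ λ_v`, so that it
is enough to follow partition functions of scaled weights while edges are removed. If `w` is
`α`-balanced, so are its restrictions, and an exchange argument shows that their scalings are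
`β`-balanced for `β = α ^ (k + 1)`, at every stage (`Homogeneous.scaled_le`).

Let `S` be an edge inside `U` and `m = |U| / k`. Expanding along a vertex, `P(x)` is an average,
with weights `x_S`, of `P(x restricted to U \ S)`, and the latter is the partition function of
the scaling of the restriction times `exp (-∑ ζ_v)`, where `exp ζ_v` are the multipliers that
rescale the restriction of `x`. The theorem follows from `-∑ ζ_v = -(k - 1) + O(1 / m)`, because
the errors add up to `O(log m)`. With `X` the total weight of the edges disjoint from `S`, a Gibbs
inequality gives `-∑ ζ_v ≤ X - (m - 1)` and, for every stochastic weight `y` on `U \ S`,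
`-∑ ζ_v ≥ X - (m - 1) - ∑ (y - x)² / x` (`Homogeneous.sub_le_sum_log_multiplier`,
`Homogeneous.sum_log_multiplier_le`). By inclusion-exclusion `X = m - k + O(1 / m)`, since edges
meeting `S` twice have total weight `O(1 / m)`. A suitable `y` is found by adding to `x` a
correction which is affine in the lost vertex sums (`Homogeneous.exists_stochastic_near`); its
relative size is `O(1 / m)`. The corrected weight is nonnegative for `m > β k ^ 2`; at
smaller levels it is enough to count one perfect matching for each edge through a fixed vertex
(`Homogeneous.inv_pow_mul_inv_pow_le_matchSum`).

Complete uniform and complete partite hypergraphs are treated together through the structure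
`Homogeneous`. The bounds with explicit constants give those with a single exponent after `α` is
increased to at least `2`, as positive constants are absorbed into powers of `m ≥ 2`.
-/

namespace HypergraphMatching

open Finset

/-! ### Matchings of vertex subsets -/

section Matchings

variable {V : Type*} [DecidableEq V]

/-- The edges of `H` that lie inside the vertex set `U`. -/
def edgesIn (H : Finset (Finset V)) (U : Finset V) : Finset (Finset V) := {S ∈ H | S ⊆ U}

/-- The edges of `H` that lie inside the vertex set `U` and contain the vertex `v`. -/
def edgesAt (H : Finset (Finset V)) (U : Finset V) (v : V) : Finset (Finset V) :=
  {S ∈ edgesIn H U | v ∈ S}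

lemma mem_edgesIn {H : Finset (Finset V)} {U S : Finset V} :
    S ∈ edgesIn H U ↔ S ∈ H ∧ S ⊆ U := by simp [edgesIn]

lemma mem_edgesAt {H : Finset (Finset V)} {U S : Finset V} {v : V} :
    S ∈ edgesAt H U v ↔ (S ∈ H ∧ S ⊆ U) ∧ v ∈ S := by simp [edgesAt, edgesIn]

/-- The perfect matchings of the sub-hypergraph of `H` induced on `U`. -/
def matchings (H : Finset (Finset V)) (U : Finset V) : Finset (Finset (Finset V)) :=
  {M ∈ H.powerset | (∀ S ∈ M, ∀ T ∈ M, S ≠ T → Disjoint S T) ∧ M.biUnion id = U}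

/-- The partition function of the sub-hypergraph of `H` induced on `U`. -/
def matchSum (H : Finset (Finset V)) (w : Finset V → ℝ) (U : Finset V) : ℝ :=
  ∑ M ∈ matchings H U, ∏ S ∈ M, w S

lemma mem_matchings {H M : Finset (Finset V)} {U : Finset V} :
    M ∈ matchings H U ↔
      M ⊆ H ∧ (∀ S ∈ M, ∀ T ∈ M, S ≠ T → Disjoint S T) ∧ M.biUnion id = U := by
  simp [matchings]

lemma partitionFunction_eq_matchSum [Fintype V] (H : Finset (Finset V)) (w : Finset V → ℝ) :
    partitionFunction H w = matchSum H w univ := by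
  unfold partitionFunction matchSum
  refine Finset.sum_congr ?_ fun _ _ => rfl
  ext M
  classical
  rw [mem_filter, mem_powerset, mem_matchings]
  simp only [IsPerfectMatching, Finset.ext_iff, mem_biUnion, id, mem_univ, iff_true]
  tauto

lemma matchSum_empty {H : Finset (Finset V)} (hH : ∀ S ∈ H, S.Nonempty) (w : Finset V → ℝ) :
    matchSum H w ∅ = 1 := by
  have : matchings H ∅ = {∅} := by
    ext M
    rw [mem_matchings, mem_singleton]
    constructor
    · rintro ⟨hM, -, hU⟩
      by_contra hne
      obtain ⟨S, hS⟩ := Finset.nonempty_iff_ne_empty.2 hne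
      obtain ⟨v, hv⟩ := hH S (hM hS)
      have : v ∈ M.biUnion id := mem_biUnion.2 ⟨S, hS, hv⟩
      simp [hU] at this
    · rintro rfl
      simp
  simp [matchSum, this]

/-- Expansion of the partition function along the edges through a fixed vertex. -/
lemma matchSum_eq_sum_edgesAt (H : Finset (Finset V)) (w : Finset V → ℝ) {U : Finset V} {v : V}
    (hv : v ∈ U) :
    matchSum H w U = ∑ S ∈ edgesAt H U v, w S * matchSum H w (U \ S) := by
  have key : ∀ S ∈ edgesAt H U v,
      w S * matchSum H w (U \ S) = ∑ M ∈ matchings H U with S ∈ M, ∏ T ∈ M, w T := by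
    intro S hS
    rw [mem_edgesAt] at hS
    obtain ⟨⟨hSH, hSU⟩, hvS⟩ := hS
    have hnot : ∀ M ∈ matchings H (U \ S), S ∉ M := by
      intro M hM hSM
      rw [mem_matchings] at hM
      have : v ∈ U \ S := by
        rw [← hM.2.2]
        exact mem_biUnion.2 ⟨S, hSM, hvS⟩
      exact (mem_sdiff.1 this).2 hvS
    rw [matchSum, mul_sum]
    refine Finset.sum_bij' (fun M _ => insert S M) (fun M _ => M.erase S) ?_ ?_ ?_ ?_ ?_
    · intro M hM
      have hn := hnot M hM
      rw [mem_matchings] at hM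
      obtain ⟨h1, h2, h3⟩ := hM
      have hd : ∀ T ∈ M, Disjoint S T := by
        intro T hT
        have : T ⊆ U \ S := by
          rw [← h3]
          exact fun x hx => mem_biUnion.2 ⟨T, hT, hx⟩
        exact disjoint_of_subset_right this disjoint_sdiff
      simp only [mem_filter, mem_matchings, mem_insert, true_or, and_true]
      refine ⟨insert_subset hSH h1, ?_, ?_⟩
      · rintro A (rfl | hA) B (rfl | hB) hAB
        · exact absurd rfl hAB
        · exact hd B hB
        · exact (hd A hA).symm
        · exact h2 A hA B hB hAB
      · rw [biUnion_insert, h3]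
        exact union_sdiff_of_subset hSU
    · intro M hM
      simp only [mem_filter, mem_matchings] at hM
      obtain ⟨⟨h1, h2, h3⟩, hSM⟩ := hM
      rw [mem_matchings]
      refine ⟨(erase_subset _ _).trans h1, ?_, ?_⟩
      · intro A hA B hB
        exact h2 A (mem_of_mem_erase hA) B (mem_of_mem_erase hB)
      · ext x
        simp only [mem_biUnion, id, mem_sdiff, mem_erase, ← h3]
        constructor
        · rintro ⟨T, ⟨hTS, hT⟩, hx⟩
          exact ⟨⟨T, hT, hx⟩, fun hxS => (Finset.disjoint_left.1 (h2 T hT S hSM hTS)) hx hxS⟩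
        · rintro ⟨⟨T, hT, hx⟩, hxS⟩
          exact ⟨T, ⟨fun h => hxS (h ▸ hx), hT⟩, hx⟩
    · intro M hM
      exact erase_insert (hnot M hM)
    · intro M hM
      exact insert_erase (mem_filter.1 hM).2
    · intro M hM
      rw [prod_insert (hnot M hM)]
  rw [Finset.sum_congr rfl key]
  simp_rw [sum_filter]
  rw [sum_comm, matchSum]
  refine Finset.sum_congr rfl fun M hM => ?_
  rw [mem_matchings] at hM
  obtain ⟨h1, h2, h3⟩ := hM
  have hvM := hv
  rw [← h3] at hvM
  obtain ⟨S, hSM, hvS⟩ := mem_biUnion.1 hvM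
  have hSU : S ⊆ U := by
    rw [← h3]
    exact fun x hx => mem_biUnion.2 ⟨S, hSM, hx⟩
  rw [Finset.sum_eq_single_of_mem S (mem_edgesAt.2 ⟨⟨h1 hSM, hSU⟩, hvS⟩), if_pos hSM]
  intro T hT hTS
  rw [if_neg]
  intro hTM
  exact Finset.disjoint_left.1 (h2 T hTM S hSM hTS) (mem_edgesAt.1 hT).2 hvS

/-- Summing over the edges inside `U`, vertex by vertex. -/
lemma sum_sum_edgesAt (H : Finset (Finset V)) (U : Finset V) (x : Finset V → ℝ) (ζ : V → ℝ) :
    ∑ v ∈ U, ζ v * ∑ T ∈ edgesAt H U v, x T = ∑ T ∈ edgesIn H U, x T * ∑ v ∈ T, ζ v := by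
  simp_rw [mul_sum, edgesAt, sum_filter]
  rw [sum_comm]
  refine Finset.sum_congr rfl fun T hT => ?_
  have hTU := (mem_edgesIn.1 hT).2
  rw [← sum_filter, filter_mem_eq_inter, inter_eq_right.2 hTU]
  exact Finset.sum_congr rfl fun _ _ => mul_comm _ _

/-- The weight `w` rescaled by the vertex multipliers `lam`. -/
def scaled (w : Finset V → ℝ) (lam : V → ℝ) (S : Finset V) : ℝ := w S * ∏ v ∈ S, lam v

/-- Positive vertex multipliers `lam` that make `w` stochastic on the sub-hypergraph of `H`
induced on `U`. -/
structure IsScaling (H : Finset (Finset V)) (w : Finset V → ℝ) (U : Finset V)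
    (lam : V → ℝ) : Prop where
  pos : ∀ v ∈ U, 0 < lam v
  sum_eq_one : ∀ v ∈ U, ∑ S ∈ edgesAt H U v, scaled w lam S = 1

lemma matchSum_scaled (H : Finset (Finset V)) (w : Finset V → ℝ) (lam : V → ℝ) (U : Finset V) :
    matchSum H (scaled w lam) U = matchSum H w U * ∏ v ∈ U, lam v := by
  rw [matchSum, matchSum, sum_mul]
  refine Finset.sum_congr rfl fun M hM => ?_
  obtain ⟨-, h2, h3⟩ := mem_matchings.1 hM
  have h := prod_biUnion (f := lam) (t := id) (s := M) fun A hA B hB h => h2 A hA B hB h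
  rw [← h3, h]
  simp [scaled, prod_mul_distrib]

end Matchings

/-! ### Homogeneous hypergraphs -/

/-- The common features of complete uniform and complete partite hypergraphs on which the
estimates rest. `Lev U j` says that `U` is the vertex set of a hypergraph of the same kind
whose perfect matchings have `j` edges, `M j` is the degree of a vertex there, and `r` sends a
vertex to its class (all vertices form one class in the uniform case, the classes are the parts
in the partite case). -/
structure Homogeneous {V ι : Type*} [DecidableEq V] (k : ℕ) (H : Finset (Finset V))
    (Lev : Finset V → ℕ → Prop) (M : ℕ → ℕ) (r : V → ι) : Prop where
  card_edge : ∀ S ∈ H, S.card = k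
  card_level : ∀ U j, Lev U j → U.card = k * j
  level_sdiff : ∀ U j S, Lev U (j + 1) → S ∈ edgesIn H U → Lev (U \ S) j
  degree : ∀ U j v, Lev U j → v ∈ U → (edgesAt H U v).card = M j
  degree_pos : ∀ j, 1 ≤ j → 0 < M j
  degree_mono : ∀ j, M j ≤ M (j + 1)
  /-- The codegree of two vertices is at most `M j / j`. -/
  codegree : ∀ U j u v, Lev U j → u ∈ U → v ∈ U → u ≠ v →
    j * ((edgesAt H U u).filter (v ∈ ·)).card ≤ M j
  /-- A vertex of an edge can be traded for any vertex of the same class. -/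
  swap : ∀ S ∈ H, ∀ u ∈ S, ∀ v, v ∉ S → r u = r v → insert v (S.erase u) ∈ H
  /-- All edges meet each class in the same number of vertices. -/
  bij : ∀ S ∈ H, ∀ T ∈ H, ∃ e : V → V, Set.BijOn e S T ∧ ∀ v ∈ S, r (e v) = r v
  /-- The map `A` from edge weights to vertex sums can be inverted on its range `A q`: up to a
  constant, `A` composed with its transpose is `b` times the identity. For large `j` the factor `b`
  is close to the degree at the next level. -/
  invert : ∀ U j, Lev U j → 4 * k ^ 2 ≤ j → ∃ b c : ℝ, 0 < b ∧ 0 ≤ c ∧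
    c * (k * j - 1) ≤ k - 1 ∧ (k : ℝ) * M (j + 1) ≤ (k + 1) * b ∧
    ∀ (q : Finset V → ℝ) (δ : V → ℝ), (∀ v ∈ U, δ v = ∑ T ∈ edgesAt H U v, q T) →
      ∀ v ∈ U, ∑ T ∈ edgesAt H U v, ∑ u ∈ T, δ u = b * δ v + M j * (c * ∑ u ∈ U, δ u)

namespace Homogeneous

variable {V ι : Type*} [DecidableEq V] {k : ℕ} {H : Finset (Finset V)}
  {Lev : Finset V → ℕ → Prop} {M : ℕ → ℕ} {r : V → ι}

lemma edge_nonempty (h : Homogeneous k H Lev M r) (hk : 1 < k) :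
    ∀ S ∈ H, S.Nonempty := by
  intro S hS
  rw [← card_pos, h.card_edge S hS]
  omega

lemma level_nonempty (h : Homogeneous k H Lev M r) (hk : 1 < k) {U : Finset V} {j : ℕ}
    (hj : 1 ≤ j) (hU : Lev U j) : U.Nonempty := by
  rw [← card_pos, h.card_level U j hU]
  exact Nat.mul_pos (by omega) hj

lemma degree_le (h : Homogeneous k H Lev M r) (hk : 1 < k) {U : Finset V} {j : ℕ}
    (hj : 1 ≤ j) (hU : Lev U j) : M j ≤ (k * j - 1).choose (k - 1) := by
  obtain ⟨v, hv⟩ := h.level_nonempty hk hj hU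
  have h1 := card_filter_powersetCard_subset _ _ k (singleton_subset_iff.2 hv)
    (by rw [card_singleton]; omega)
  rw [card_singleton, h.card_level U j hU] at h1
  rw [← h1, ← h.degree U j v hU hv]
  refine card_le_card fun T hT => ?_
  rw [mem_edgesAt] at hT
  rw [mem_filter, mem_powersetCard, singleton_subset_iff]
  exact ⟨⟨hT.1.2, h.card_edge T hT.1.1⟩, hT.2⟩

/-- The total weight of a weight whose vertex sums are `1` is the level. -/
lemma sum_edgesIn (h : Homogeneous k H Lev M r) (hk : 1 < k) {U : Finset V} {j : ℕ}
    (hU : Lev U j) {x : Finset V → ℝ} (hx : ∀ v ∈ U, ∑ S ∈ edgesAt H U v, x S = 1) :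
    ∑ S ∈ edgesIn H U, x S = j := by
  have h1 := sum_sum_edgesAt H U x (fun _ => 1)
  have h2 : ∑ v ∈ U, (1 : ℝ) * ∑ T ∈ edgesAt H U v, x T = k * j := by
    rw [Finset.sum_congr rfl fun v hv => by rw [hx v hv]]
    simp [h.card_level U j hU]
  have h3 : ∑ T ∈ edgesIn H U, x T * ∑ v ∈ T, (1 : ℝ) = k * ∑ T ∈ edgesIn H U, x T := by
    rw [mul_sum]
    refine Finset.sum_congr rfl fun T hT => ?_
    simp [h.card_edge T (mem_edgesIn.1 hT).1, mul_comm]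
  have hk0 : (k : ℝ) ≠ 0 := by positivity
  exact mul_left_cancel₀ hk0 (by rw [← h3, ← h1, h2])

lemma card_edgesIn (h : Homogeneous k H Lev M r) (hk : 1 < k) {U : Finset V} {j : ℕ}
    (hj : 1 ≤ j) (hU : Lev U j) : ((edgesIn H U).card : ℝ) = j * M j := by
  have hM : (M j : ℝ) ≠ 0 := by exact_mod_cast (h.degree_pos j hj).ne'
  have := h.sum_edgesIn hk hU (x := fun _ => (M j : ℝ)⁻¹) fun v hv => by
    simp [h.degree U j v hU hv, hM]
  rw [sum_const, nsmul_eq_mul] at this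
  field_simp at this
  linarith

/-! ### Balancedness of scalings -/

/-- Trading `u` for `v` in the edges containing `u` but not `v`: multipliers of vertices of one
class are within a factor of `α` of each other. -/
lemma multiplier_le (h : Homogeneous k H Lev M r) {U : Finset V} {j : ℕ}
    (hj : 2 ≤ j) (hU : Lev U j) {α : ℝ} (hα : 1 ≤ α) {w : Finset V → ℝ} (hw : IsBalanced α H w)
    {lam : V → ℝ} (hl : IsScaling H w U lam) {u v : V} (hu : u ∈ U) (hv : v ∈ U)
    (huv : r u = r v) : lam u ≤ α * lam v := by
  by_contra hlt
  push Not at hlt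
  have hv0 := hl.pos v hv
  have hne : u ≠ v := by
    rintro rfl
    nlinarith
  have hwT : ∀ T, T ∈ H → 0 < w T := hw.1
  have e1 := sum_filter_add_sum_filter_not (edgesAt H U u) (v ∈ ·) (scaled w lam)
  have e2 := sum_filter_add_sum_filter_not (edgesAt H U v) (u ∈ ·) (scaled w lam)
  rw [hl.sum_eq_one u hu] at e1
  rw [hl.sum_eq_one v hv] at e2
  have e3 : (edgesAt H U u).filter (v ∈ ·) = (edgesAt H U v).filter (u ∈ ·) := by
    ext T
    simp only [mem_filter, mem_edgesAt]
    tauto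
  rw [e3] at e1
  have e4 : ∑ S ∈ edgesAt H U u with v ∉ S, scaled w lam S =
      ∑ S ∈ edgesAt H U v with u ∉ S, scaled w lam S := by linarith
  have e5 : ∑ S ∈ edgesAt H U v with u ∉ S, scaled w lam S =
      ∑ S ∈ edgesAt H U u with v ∉ S, scaled w lam (insert v (S.erase u)) := by
    symm
    refine Finset.sum_bij' (fun S _ => insert v (S.erase u)) (fun S _ => insert u (S.erase v))
      ?_ ?_ ?_ ?_ (fun _ _ => rfl)
    · intro S hS
      simp only [mem_filter, mem_edgesAt] at hS ⊢
      obtain ⟨⟨⟨h1, h2⟩, h3⟩, h4⟩ := hS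
      refine ⟨⟨⟨h.swap S h1 u h3 v h4 huv, insert_subset hv ((erase_subset _ _).trans h2)⟩,
        mem_insert_self _ _⟩, ?_⟩
      simp [hne]
    · intro S hS
      simp only [mem_filter, mem_edgesAt] at hS ⊢
      obtain ⟨⟨⟨h1, h2⟩, h3⟩, h4⟩ := hS
      refine ⟨⟨⟨h.swap S h1 v h3 u h4 huv.symm, insert_subset hu ((erase_subset _ _).trans h2)⟩,
        mem_insert_self _ _⟩, ?_⟩
      simp [hne.symm]
    · intro S hS
      simp only [mem_filter, mem_edgesAt] at hS
      rw [erase_insert (by simp [hS.2]), insert_erase hS.1.2]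
    · intro S hS
      simp only [mem_filter, mem_edgesAt] at hS
      rw [erase_insert (by simp [hS.2]), insert_erase hS.1.2]
  rw [e5] at e4
  refine (ne_of_gt (Finset.sum_lt_sum_of_nonempty ?_ ?_)) e4
  · rw [← card_pos]
    have c1 := card_filter_add_card_filter_not (s := edgesAt H U u) (v ∈ ·)
    rw [h.degree U j u hU hu] at c1
    have c2 := h.codegree U j u v hU hu hv hne
    have c3 := h.degree_pos j (by omega)
    by_contra hc
    have : ((edgesAt H U u).filter (v ∈ ·)).card = M j := by omega
    rw [this] at c2
    nlinarith
  · intro S hS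
    simp only [mem_filter, mem_edgesAt] at hS
    obtain ⟨⟨⟨h1, h2⟩, h3⟩, h4⟩ := hS
    have hS' := h.swap S h1 u h3 v h4 huv
    have hp : 0 < ∏ x ∈ S.erase u, lam x :=
      prod_pos fun x hx => hl.pos x (h2 (mem_of_mem_erase hx))
    rw [scaled, scaled, prod_insert (by simp [h4]), ← mul_prod_erase S lam h3]
    have hr := hw.2 _ hS' _ h1
    rw [div_le_iff₀ (hwT _ h1)] at hr
    calc w (insert v (S.erase u)) * (lam v * ∏ x ∈ S.erase u, lam x)
        ≤ (α * w S) * (lam v * ∏ x ∈ S.erase u, lam x) := by gcongr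
      _ = w S * ((α * lam v) * ∏ x ∈ S.erase u, lam x) := by ring
      _ < _ := by
        have := hwT _ h1
        gcongr

/-- A scaling of an `α`-balanced weight is `α ^ (k + 1)`-balanced. -/
lemma scaled_le (h : Homogeneous k H Lev M r) {U : Finset V} {j : ℕ}
    (hj : 2 ≤ j) (hU : Lev U j) {α : ℝ} (hα : 1 ≤ α) {w : Finset V → ℝ} (hw : IsBalanced α H w)
    {lam : V → ℝ} (hl : IsScaling H w U lam) {S T : Finset V} (hS : S ∈ edgesIn H U)
    (hT : T ∈ edgesIn H U) : scaled w lam S ≤ α ^ (k + 1) * scaled w lam T := by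
  rw [mem_edgesIn] at hS hT
  obtain ⟨e, he, her⟩ := h.bij S hS.1 T hT.1
  have h1 : ∏ v ∈ T, lam v = ∏ v ∈ S, lam (e v) :=
    (prod_nbij e (fun v hv => he.mapsTo hv) he.injOn he.surjOn fun _ _ => rfl).symm
  have h2 : ∏ v ∈ S, lam v ≤ α ^ k * ∏ v ∈ T, lam v := by
    rw [h1, ← h.card_edge S hS.1, ← prod_const, ← prod_mul_distrib]
    refine prod_le_prod (fun v hv => (hl.pos v (hS.2 hv)).le) fun v hv => ?_
    exact h.multiplier_le hj hU hα hw hl (hS.2 hv) (hT.2 (he.mapsTo hv)) (her v hv).symm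
  have hr := hw.2 _ hS.1 _ hT.1
  have hwT := hw.1 _ hT.1
  rw [div_le_iff₀ hwT] at hr
  have hpos : 0 < ∏ v ∈ S, lam v := prod_pos fun v hv => hl.pos v (hS.2 hv)
  calc w S * ∏ v ∈ S, lam v ≤ (α * w T) * (α ^ k * ∏ v ∈ T, lam v) := by gcongr
    _ = _ := by rw [scaled]; ring

end Homogeneous

/-! ### Edge weights and codegrees of a balanced stochastic weight -/

/-- A positive weight on the edges inside `U`, with all vertex sums equal to `1`, whose values
are within a factor of `β` of each other. -/
structure IsBalancedStochastic {V : Type*} [DecidableEq V] (β : ℝ) (H : Finset (Finset V))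
    (U : Finset V) (x : Finset V → ℝ) : Prop where
  pos : ∀ S ∈ edgesIn H U, 0 < x S
  le : ∀ S ∈ edgesIn H U, ∀ T ∈ edgesIn H U, x S ≤ β * x T
  sum_eq_one : ∀ v ∈ U, ∑ S ∈ edgesAt H U v, x S = 1

lemma IsScaling.scaled_pos {V : Type*} [DecidableEq V] {H : Finset (Finset V)} {U : Finset V}
    {α : ℝ} {w : Finset V → ℝ} (hw : IsBalanced α H w) {lam : V → ℝ}
    (hl : IsScaling H w U lam) {S : Finset V} (hS : S ∈ edgesIn H U) : 0 < scaled w lam S :=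
  mul_pos (hw.1 S (mem_edgesIn.1 hS).1)
    (prod_pos fun v hv => hl.pos v ((mem_edgesIn.1 hS).2 hv))

namespace Homogeneous

variable {V ι : Type*} [DecidableEq V] {k : ℕ} {H : Finset (Finset V)}
  {Lev : Finset V → ℕ → Prop} {M : ℕ → ℕ} {r : V → ι}

lemma isBalancedStochastic_scaled (h : Homogeneous k H Lev M r) {U : Finset V} {j : ℕ}
    (hj : 2 ≤ j) (hU : Lev U j) {α : ℝ} (hα : 1 ≤ α) {w : Finset V → ℝ} (hw : IsBalanced α H w)
    {lam : V → ℝ} (hl : IsScaling H w U lam) :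
    IsBalancedStochastic (α ^ (k + 1)) H U (scaled w lam) where
  pos _ hS := hl.scaled_pos hw hS
  le _ hS _ hT := h.scaled_le hj hU hα hw hl hS hT
  sum_eq_one := hl.sum_eq_one

section

variable {U : Finset V} {j : ℕ} {β : ℝ} {x : Finset V → ℝ}

lemma mul_weight_le (h : Homogeneous k H Lev M r) (hk : 1 < k) (hj : 1 ≤ j) (hU : Lev U j)
    (hx : IsBalancedStochastic β H U x) {S : Finset V} (hS : S ∈ edgesIn H U) :
    M j * x S ≤ β := by
  obtain ⟨v, hv⟩ := h.level_nonempty hk hj hU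
  have h1 : ∑ T ∈ edgesAt H U v, x S ≤ ∑ T ∈ edgesAt H U v, β * x T :=
    sum_le_sum fun T hT => hx.le S hS T (mem_filter.1 hT).1
  rw [← mul_sum, hx.sum_eq_one v hv, sum_const, nsmul_eq_mul, h.degree U j v hU hv] at h1
  linarith

lemma one_le_mul_weight (h : Homogeneous k H Lev M r) (hk : 1 < k) (hj : 1 ≤ j) (hU : Lev U j)
    (hx : IsBalancedStochastic β H U x) {S : Finset V} (hS : S ∈ edgesIn H U) :
    1 ≤ β * M j * x S := by
  obtain ⟨v, hv⟩ := h.level_nonempty hk hj hU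
  have h1 : ∑ T ∈ edgesAt H U v, x T ≤ ∑ T ∈ edgesAt H U v, β * x S :=
    sum_le_sum fun T hT => hx.le T (mem_filter.1 hT).1 S hS
  rw [hx.sum_eq_one v hv, sum_const, nsmul_eq_mul, h.degree U j v hU hv] at h1
  linarith

lemma sum_codegree_le (h : Homogeneous k H Lev M r) (hk : 1 < k) (hj : 1 ≤ j) (hU : Lev U j)
    (hβ : 0 ≤ β) (hx : IsBalancedStochastic β H U x) {u v : V} (hu : u ∈ U) (hv : v ∈ U)
    (huv : u ≠ v) : ∑ T ∈ edgesAt H U u with v ∈ T, x T ≤ β / j := by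
  have hM : (0 : ℝ) < M j := by exact_mod_cast h.degree_pos j hj
  have hj0 : (0 : ℝ) < j := by exact_mod_cast hj
  have hc : (j : ℝ) * ((edgesAt H U u).filter (v ∈ ·)).card ≤ M j := by
    exact_mod_cast h.codegree U j u v hU hu hv huv
  have h1 : ∑ T ∈ edgesAt H U u with v ∈ T, x T ≤
      ((edgesAt H U u).filter (v ∈ ·)).card • (β / M j) := by
    refine sum_le_card_nsmul _ _ _ fun T hT => ?_
    rw [le_div_iff₀ hM, mul_comm]
    exact h.mul_weight_le hk hj hU hx (mem_filter.1 (mem_filter.1 hT).1).1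
  rw [nsmul_eq_mul] at h1
  refine h1.trans ?_
  rw [le_div_iff₀ hj0]
  calc _ = (j * ((edgesAt H U u).filter (v ∈ ·)).card : ℝ) * (β / M j) := by ring
    _ ≤ M j * (β / M j) := by gcongr
    _ = β := by field_simp

/-! ### The weight that survives the removal of an edge -/

lemma edgesIn_sdiff (S : Finset V) :
    edgesIn H (U \ S) = (edgesIn H U).filter fun T => (T ∩ S).card = 0 := by
  ext T
  simp only [mem_filter, mem_edgesIn, subset_sdiff, card_eq_zero, disjoint_iff_inter_eq_empty]
  tauto

/-- Each of the `k` vertices of `S` kills weight `1`, but an edge meeting `S` in several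
vertices is counted several times. -/
lemma surviving_eq (h : Homogeneous k H Lev M r) (hk : 1 < k) (hU : Lev U j)
    (hx : IsBalancedStochastic β H U x) {S : Finset V} (hS : S ∈ edgesIn H U) :
    ∑ T ∈ edgesIn H (U \ S), x T = j - k +
      ∑ T ∈ (edgesIn H U).filter (fun T => (T ∩ S).card ≠ 0), x T * ((T ∩ S).card - 1) := by
  have hSU := (mem_edgesIn.1 hS).2
  have h1 := h.sum_edgesIn hk hU hx.sum_eq_one
  have h2 : ∑ T ∈ edgesIn H U, x T * ((T ∩ S).card : ℝ) = k := by
    have := sum_sum_edgesAt H U x (fun v => if v ∈ S then 1 else 0)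
    rw [Finset.sum_congr rfl fun v hv => by rw [hx.sum_eq_one v hv]] at this
    simp only [mul_one, sum_ite_mem, sum_const, nsmul_eq_mul] at this
    rw [inter_eq_right.2 hSU, h.card_edge S (mem_edgesIn.1 hS).1] at this
    exact this.symm
  have h3 := sum_filter_add_sum_filter_not (edgesIn H U) (fun T => (T ∩ S).card = 0)
    (fun T => x T * ((T ∩ S).card - 1 : ℝ))
  have h4 : ∑ T ∈ edgesIn H U, x T * ((T ∩ S).card - 1 : ℝ) = k - j := by
    simp_rw [mul_sub, mul_one]
    rw [sum_sub_distrib, h2, h1]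
  have h5 : ∑ T ∈ edgesIn H U with (T ∩ S).card = 0, x T * ((T ∩ S).card - 1 : ℝ) =
      - ∑ T ∈ edgesIn H (U \ S), x T := by
    rw [edgesIn_sdiff, ← sum_neg_distrib]
    refine Finset.sum_congr rfl fun T hT => ?_
    rw [(mem_filter.1 hT).2]
    simp
  rw [h4, h5] at h3
  linarith

lemma le_surviving (h : Homogeneous k H Lev M r) (hk : 1 < k) (hU : Lev U j)
    (hx : IsBalancedStochastic β H U x) {S : Finset V} (hS : S ∈ edgesIn H U) :
    (j : ℝ) - k ≤ ∑ T ∈ edgesIn H (U \ S), x T := by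
  rw [h.surviving_eq hk hU hx hS, le_add_iff_nonneg_right]
  refine sum_nonneg fun T hT => mul_nonneg (hx.pos T (mem_filter.1 hT).1).le ?_
  have : 1 ≤ (T ∩ S).card := Nat.one_le_iff_ne_zero.2 (mem_filter.1 hT).2
  have : (1 : ℝ) ≤ (T ∩ S).card := by exact_mod_cast this
  linarith

lemma surviving_le (h : Homogeneous k H Lev M r) (hk : 1 < k) (hj : 1 ≤ j) (hU : Lev U j)
    (hβ : 0 ≤ β) (hx : IsBalancedStochastic β H U x) {S : Finset V} (hS : S ∈ edgesIn H U) :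
    ∑ T ∈ edgesIn H (U \ S), x T ≤ j - k + k ^ 2 * β / 2 / j := by
  rw [h.surviving_eq hk hU hx hS, add_le_add_iff_left]
  have hSU := (mem_edgesIn.1 hS).2
  have hSk := h.card_edge S (mem_edgesIn.1 hS).1
  have hj0 : (0 : ℝ) < j := by exact_mod_cast hj
  -- the number of ordered pairs of distinct vertices of `T ∩ S` dominates `2 * (card - 1)`
  have h1 : ∑ T ∈ (edgesIn H U).filter (fun T => (T ∩ S).card ≠ 0),
      x T * ((T ∩ S).card - 1 : ℝ) ≤
      ∑ T ∈ edgesIn H U, x T * (((S ∩ T).offDiag.card : ℝ) / 2) := by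
    refine (sum_le_sum fun T hT => ?_).trans
      (sum_le_sum_of_subset_of_nonneg (filter_subset (fun T => (T ∩ S).card ≠ 0) _)
        fun T hT _ => ?_)
    · have h0 : 1 ≤ (T ∩ S).card := Nat.one_le_iff_ne_zero.2 (mem_filter.1 hT).2
      have h0' : (1 : ℝ) ≤ (T ∩ S).card := by exact_mod_cast h0
      refine mul_le_mul_of_nonneg_left ?_ (hx.pos T (mem_filter.1 hT).1).le
      rw [inter_comm S T, offDiag_card, Nat.cast_sub (Nat.le_mul_self _), Nat.cast_mul]
      nlinarith [sq_nonneg (((T ∩ S).card : ℝ) - 2), h0,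
        show 0 ≤ (((T ∩ S).card : ℝ) - 1) * ((T ∩ S).card - 2) by
          rcases Nat.lt_or_ge (T ∩ S).card 2 with h2 | h2
          · have : (T ∩ S).card = 1 := by omega
            simp [this]
          · have : (2 : ℝ) ≤ (T ∩ S).card := by exact_mod_cast h2
            exact mul_nonneg (by linarith) (by linarith)]
    · exact mul_nonneg (hx.pos T hT).le (by positivity)
  refine h1.trans ?_
  have h2 : ∑ T ∈ edgesIn H U, x T * (((S ∩ T).offDiag.card : ℝ) / 2) =
      ∑ p ∈ S.offDiag, (∑ T ∈ edgesAt H U p.1 with p.2 ∈ T, x T) / 2 := by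
    simp_rw [edgesAt, filter_filter, ← sum_div, sum_filter]
    rw [sum_comm, sum_div]
    refine Finset.sum_congr rfl fun T _ => ?_
    rw [← sum_filter, sum_const, nsmul_eq_mul]
    have : (S ∩ T).offDiag = S.offDiag.filter fun p => p.1 ∈ T ∧ p.2 ∈ T := by
      ext p
      simp only [mem_offDiag, mem_filter, mem_inter]
      tauto
    rw [this]
    ring
  rw [h2]
  have h3 : ∑ p ∈ S.offDiag, (∑ T ∈ edgesAt H U p.1 with p.2 ∈ T, x T) / 2 ≤
      S.offDiag.card • (β / j / 2) := by
    refine sum_le_card_nsmul _ _ _ fun p hp => ?_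
    rw [mem_offDiag] at hp
    have := h.sum_codegree_le hk hj hU hβ hx (hSU hp.1) (hSU hp.2.1) hp.2.2
    linarith
  refine h3.trans ?_
  rw [nsmul_eq_mul]
  have h4 : (S.offDiag.card : ℝ) ≤ k ^ 2 := by
    rw [offDiag_card, hSk, sq]
    exact_mod_cast Nat.sub_le _ _
  calc (S.offDiag.card : ℝ) * (β / j / 2) ≤ k ^ 2 * (β / j / 2) := by gcongr
    _ = _ := by ring

/-- The vertex sums lost by removing the edge `S` are small. -/
lemma one_sub_degree_le (h : Homogeneous k H Lev M r) (hk : 1 < k) (hj : 1 ≤ j) (hU : Lev U j)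
    (hβ : 0 ≤ β) (hx : IsBalancedStochastic β H U x) {S : Finset V} (hS : S ∈ edgesIn H U)
    {v : V} (hv : v ∈ U \ S) :
    0 ≤ 1 - ∑ T ∈ edgesAt H (U \ S) v, x T ∧
      1 - ∑ T ∈ edgesAt H (U \ S) v, x T ≤ k * β / j := by
  obtain ⟨hvU, hvS⟩ := mem_sdiff.1 hv
  have hSU := (mem_edgesIn.1 hS).2
  have hSk := h.card_edge S (mem_edgesIn.1 hS).1
  have e1 : edgesAt H (U \ S) v = (edgesAt H U v).filter fun T => (T ∩ S).card = 0 := by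
    rw [edgesAt, edgesAt, edgesIn_sdiff, filter_filter, filter_filter]
    simp_rw [and_comm]
  have e2 := sum_filter_add_sum_filter_not (edgesAt H U v) (fun T => (T ∩ S).card = 0) x
  rw [hx.sum_eq_one v hvU, ← e1] at e2
  have e3 : 1 - ∑ T ∈ edgesAt H (U \ S) v, x T =
      ∑ T ∈ edgesAt H U v with (T ∩ S).card ≠ 0, x T := by linarith
  have hpos : ∀ T ∈ edgesAt H U v, 0 ≤ x T := fun T hT => (hx.pos T (mem_filter.1 hT).1).le
  rw [e3]
  refine ⟨sum_nonneg fun T hT => hpos T (mem_filter.1 hT).1, ?_⟩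
  have h1 : ∑ T ∈ edgesAt H U v with (T ∩ S).card ≠ 0, x T ≤
      ∑ T ∈ edgesAt H U v, x T * ((S ∩ T).card : ℝ) := by
    refine (sum_le_sum fun T hT => ?_).trans
      (sum_le_sum_of_subset_of_nonneg (filter_subset (fun T => (T ∩ S).card ≠ 0) _)
        fun T hT _ => ?_)
    · have h0 : 1 ≤ (T ∩ S).card := Nat.one_le_iff_ne_zero.2 (mem_filter.1 hT).2
      have h0' : (1 : ℝ) ≤ (S ∩ T).card := by rw [inter_comm]; exact_mod_cast h0
      exact le_mul_of_one_le_right (hpos T (mem_filter.1 hT).1) h0'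
    · exact mul_nonneg (hpos T hT) (by positivity)
  have h2 : ∑ T ∈ edgesAt H U v, x T * ((S ∩ T).card : ℝ) =
      ∑ s ∈ S, ∑ T ∈ edgesAt H U v with s ∈ T, x T := by
    simp_rw [sum_filter (s := edgesAt H U v)]
    rw [sum_comm]
    refine Finset.sum_congr rfl fun T _ => ?_
    rw [sum_ite_mem, sum_const, nsmul_eq_mul, mul_comm]
  have h3 : ∑ s ∈ S, ∑ T ∈ edgesAt H U v with s ∈ T, x T ≤ S.card • (β / j) := by
    refine sum_le_card_nsmul _ _ _ fun s hs => ?_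
    exact h.sum_codegree_le hk hj hU hβ hx hvU (hSU hs) (by rintro rfl; exact hvS hs)
  rw [hSk, nsmul_eq_mul] at h3
  rw [mul_div_assoc]
  linarith

end

end Homogeneous

/-! ### Existence of scalings -/

/-- The convex function `w e ^ t - c t` grows at least linearly in both directions. -/
lemma exists_mul_abs_sub_le {w c : ℝ} (hw : 0 < w) (hc : 0 < c) :
    ∃ K : ℝ, ∀ t : ℝ, c * |t| - K ≤ w * Real.exp t - c * t := by
  set s := Real.log (2 * c / w) with hs
  refine ⟨2 * c * |s|, fun t => ?_⟩
  have h1 : w * Real.exp t = 2 * c * Real.exp (t - s) := by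
    rw [Real.exp_sub, hs, Real.exp_log (by positivity)]
    field_simp
  have h2 := Real.add_one_le_exp (t - s)
  rcases le_total 0 t with ht | ht
  · rw [abs_of_nonneg ht, h1]
    nlinarith [le_abs_self s]
  · rw [abs_of_nonpos ht]
    have := mul_pos hw (Real.exp_pos t)
    nlinarith [mul_nonneg hc.le (abs_nonneg s)]

namespace Homogeneous

variable {V ι : Type*} [DecidableEq V] {k : ℕ} {H : Finset (Finset V)}
  {Lev : Finset V → ℕ → Prop} {M : ℕ → ℕ} {r : V → ι}

open Filter in
/-- The logarithms of the multipliers minimise a convex function of the edge sums of `ζ`. It is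
coercive because the constant weight `1 / M j` has all vertex sums equal to `1`, and a
minimum on the (closed) space of edge sums is a stationary point. -/
lemma exists_isScaling (h : Homogeneous k H Lev M r) {U : Finset V} {j : ℕ}
    (hj : 1 ≤ j) (hU : Lev U j) {w : Finset V → ℝ} (hw : ∀ S ∈ H, 0 < w S) :
    ∃ lam : V → ℝ, IsScaling H w U lam := by
  have hM : (0 : ℝ) < M j := by exact_mod_cast h.degree_pos j hj
  set c : ℝ := (M j : ℝ)⁻¹ with hc
  have hc0 : 0 < c := by positivity
  let L : (V → ℝ) →ₗ[ℝ] (edgesIn H U → ℝ) :=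
    { toFun := fun ζ T => ∑ v ∈ T.1, ζ v
      map_add' := fun a b => by ext T; simp [sum_add_distrib]
      map_smul' := fun a b => by ext T; simp [mul_sum] }
  let g : (edgesIn H U → ℝ) → ℝ := fun τ => ∑ T, (w T.1 * Real.exp (τ T) - c * τ T)
  have hwE : ∀ T : edgesIn H U, 0 < w T.1 := fun T => hw _ (mem_edgesIn.1 T.2).1
  choose K hK using fun T : edgesIn H U => exists_mul_abs_sub_le (hwE T) hc0
  have hcoer : ∀ τ, c * ‖τ‖ - ∑ T, K T ≤ g τ := by
    intro τ
    have h1 : ‖τ‖ ≤ ∑ T, |τ T| := by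
      rw [pi_norm_le_iff_of_nonneg (sum_nonneg fun _ _ => abs_nonneg _)]
      intro T
      exact single_le_sum (f := fun T => |τ T|) (fun _ _ => abs_nonneg _) (mem_univ T)
    calc c * ‖τ‖ - ∑ T, K T ≤ c * ∑ T, |τ T| - ∑ T, K T := by gcongr
      _ = ∑ T, (c * |τ T| - K T) := by rw [sum_sub_distrib, mul_sum]
      _ ≤ g τ := sum_le_sum fun T _ => hK T (τ T)
  have hev : ∀ᶠ τ in cocompact (edgesIn H U → ℝ) ⊓ 𝓟 (LinearMap.range L : Set _), g 0 ≤ g τ := by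
    refine Filter.Eventually.filter_mono inf_le_left ?_
    filter_upwards [(tendsto_norm_cocompact_atTop (E := edgesIn H U → ℝ)).eventually_ge_atTop
      ((g 0 + ∑ T, K T) / c)] with τ hτ
    rw [div_le_iff₀ hc0] at hτ
    have := hcoer τ
    linarith
  have hgc : Continuous g := by fun_prop
  obtain ⟨τ, ⟨ζ, rfl⟩, hmin⟩ := ContinuousOn.exists_isMinOn' hgc.continuousOn
    (LinearMap.range L).closed_of_finiteDimensional (LinearMap.range L).zero_mem hev
  refine ⟨fun v => Real.exp (ζ v), fun v _ => Real.exp_pos _, fun v hv => ?_⟩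
  let a : edgesIn H U → ℝ := fun T => if v ∈ T.1 then 1 else 0
  have hline : ∀ t : ℝ, L (ζ + t • Pi.single v 1) = fun T => L ζ T + t * a T := by
    intro t
    ext T
    simp only [map_add, map_smul, Pi.add_apply, Pi.smul_apply, smul_eq_mul]
    congr 2
    simp [L, a]
  have hd : HasDerivAt (fun t : ℝ => g (fun T => L ζ T + t * a T))
      (∑ T, (w T.1 * (Real.exp (L ζ T + 0 * a T) * a T) - c * a T)) 0 := by
    refine HasDerivAt.fun_sum fun T _ => ?_
    have h0 : HasDerivAt (fun t : ℝ => L ζ T + t * a T) (a T) 0 := by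
      simpa using ((hasDerivAt_id (0 : ℝ)).mul_const (a T)).const_add (L ζ T)
    exact (h0.exp.const_mul _).sub (h0.const_mul c)
  have hlm : IsLocalMin (fun t : ℝ => g (fun T => L ζ T + t * a T)) 0 := by
    refine Filter.Eventually.of_forall fun t => ?_
    have := hmin (Set.mem_range_self (ζ + t • Pi.single v 1))
    simp only [hline, Set.mem_ofPred_eq] at this
    simpa using this
  have hz := hlm.hasDerivAt_eq_zero hd
  rw [sum_sub_distrib, ← mul_sum] at hz
  have e1 : ∑ T : edgesIn H U, a T = M j := by
    rw [← h.degree U j v hU hv, edgesAt, card_filter]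
    push_cast
    exact sum_coe_sort (edgesIn H U) (fun T => if v ∈ T then (1 : ℝ) else 0)
  have e2 : ∑ T : edgesIn H U, w T.1 * (Real.exp (L ζ T + 0 * a T) * a T) =
      ∑ S ∈ edgesAt H U v, scaled w (fun v => Real.exp (ζ v)) S := by
    rw [edgesAt, sum_filter, ← sum_coe_sort (edgesIn H U)]
    refine Finset.sum_congr rfl fun T _ => ?_
    simp only [a, scaled, ← Real.exp_sum]
    split_ifs <;> simp [L]
  rw [e1, e2, hc, inv_mul_cancel₀ hM.ne'] at hz
  linarith

/-! ### Comparison of scalings before and after the removal of an edge -/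

section

variable {U : Finset V} {j : ℕ} {β : ℝ} {x : Finset V → ℝ} {ζ : V → ℝ}

lemma sum_eq_sum_edgesIn_mul {y : Finset V → ℝ} (ζ : V → ℝ)
    (hy : ∀ v ∈ U, ∑ T ∈ edgesAt H U v, y T = 1) :
    ∑ v ∈ U, ζ v = ∑ T ∈ edgesIn H U, y T * ∑ v ∈ T, ζ v := by
  rw [← sum_sum_edgesAt]
  exact Finset.sum_congr rfl fun v hv => by rw [hy v hv, mul_one]

/-- If multiplying `x` by `exp (∑ ζ)` makes it stochastic, then `∑ ζ` is at least the
deficiency of the total weight of `x`. -/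
lemma sub_le_sum_log_multiplier (h : Homogeneous k H Lev M r) (hk : 1 < k) (hU : Lev U j)
    (hx : ∀ T ∈ edgesIn H U, 0 < x T)
    (hy : ∀ v ∈ U, ∑ T ∈ edgesAt H U v, x T * Real.exp (∑ u ∈ T, ζ u) = 1) :
    j - ∑ T ∈ edgesIn H U, x T ≤ ∑ v ∈ U, ζ v := by
  rw [sum_eq_sum_edgesIn_mul ζ hy, ← h.sum_edgesIn hk hU hy, ← sum_sub_distrib]
  refine sum_le_sum fun T hT => ?_
  set s := ∑ u ∈ T, ζ u
  have h1 := Real.add_one_le_exp (-s)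
  have h2 : Real.exp s * Real.exp (-s) = 1 := by rw [← Real.exp_add]; simp
  have h3 : Real.exp s - 1 ≤ Real.exp s * s := by nlinarith [Real.exp_pos s]
  have := hx T hT
  nlinarith

/-- The pointwise form of the Gibbs variational inequality, with the relative entropy bounded
by a quadratic expression. -/
lemma mul_le_exp_add {s z : ℝ} (hs : 0 ≤ s) : s * z ≤ Real.exp z - s + (s ^ 2 - s) := by
  rcases hs.eq_or_lt with rfl | hs
  · simpa using (Real.exp_pos z).le
  · have h1 := Real.add_one_le_exp (z - Real.log s)
    rw [Real.exp_sub, Real.exp_log hs, le_div_iff₀ hs] at h1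
    have h2 := Real.log_le_sub_one_of_pos hs
    nlinarith

/-- Any stochastic weight `y'` close to `x` certifies an upper bound on `∑ ζ`. -/
lemma sum_log_multiplier_le (h : Homogeneous k H Lev M r) (hk : 1 < k) (hU : Lev U j)
    (hx : ∀ T ∈ edgesIn H U, 0 < x T)
    (hy : ∀ v ∈ U, ∑ T ∈ edgesAt H U v, x T * Real.exp (∑ u ∈ T, ζ u) = 1)
    {y' : Finset V → ℝ} (hy0 : ∀ T ∈ edgesIn H U, 0 ≤ y' T)
    (hy' : ∀ v ∈ U, ∑ T ∈ edgesAt H U v, y' T = 1) :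
    ∑ v ∈ U, ζ v ≤
      j - ∑ T ∈ edgesIn H U, x T + ∑ T ∈ edgesIn H U, (y' T - x T) ^ 2 / x T := by
  have h1 : ∑ v ∈ U, ζ v ≤ ∑ T ∈ edgesIn H U, (x T * Real.exp (∑ u ∈ T, ζ u) -
      x T + (y' T - x T) ^ 2 / x T) := by
    rw [sum_eq_sum_edgesIn_mul ζ hy']
    refine sum_le_sum fun T hT => ?_
    have hxT := hx T hT
    have := mul_le_exp_add (s := y' T / x T) (z := ∑ u ∈ T, ζ u) (div_nonneg (hy0 T hT) hxT.le)
    have h2 := mul_le_mul_of_nonneg_left this hxT.le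
    have e1 : x T * (y' T / x T * ∑ u ∈ T, ζ u) = y' T * ∑ u ∈ T, ζ u := by field_simp
    have e2 : x T * (Real.exp (∑ u ∈ T, ζ u) - y' T / x T + ((y' T / x T) ^ 2 - y' T / x T)) =
        x T * Real.exp (∑ u ∈ T, ζ u) - x T + (y' T - x T) ^ 2 / x T := by
      field_simp
      ring
    rw [e1, e2] at h2
    exact h2
  rwa [sum_add_distrib, sum_sub_distrib, h.sum_edgesIn hk hU hy] at h1

/-- After the removal of an edge, the remaining weight `x` is corrected to a stochastic weight
by adding the combination of the lost vertex sums given by `Homogeneous.invert`. The correction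
is of relative order `1 / j`. -/
lemma exists_stochastic_near (h : Homogeneous k H Lev M r) (hk : 1 < k)
    (hj : 4 * k ^ 2 ≤ j) (hβ : 1 ≤ β) (hjβ : β * k ^ 2 ≤ j) (hU : Lev U (j + 1))
    (hx : IsBalancedStochastic β H U x) {S : Finset V} (hS : S ∈ edgesIn H U) :
    ∃ y : Finset V → ℝ, (∀ T ∈ edgesIn H (U \ S), 0 ≤ y T) ∧
      (∀ v ∈ U \ S, ∑ T ∈ edgesAt H (U \ S) v, y T = 1) ∧
      ∑ T ∈ edgesIn H (U \ S), (y T - x T) ^ 2 / x T ≤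
        β ^ 3 * ((k : ℝ) ^ 2 + k) ^ 2 / (j + 1) := by
  have hk1 : (2 : ℝ) ≤ k := by exact_mod_cast hk
  have hj1 : 1 ≤ j := by nlinarith
  have hj1' : (1 : ℝ) ≤ j := by exact_mod_cast hj1
  have hU' := h.level_sdiff U j S hU hS
  have hcard : ((U \ S).card : ℝ) = k * j := by exact_mod_cast h.card_level _ _ hU'
  have hMj : (0 : ℝ) < M j := by exact_mod_cast h.degree_pos j hj1
  have hMm : (0 : ℝ) < M (j + 1) := by exact_mod_cast h.degree_pos (j + 1) (by omega)
  have hMle : (M j : ℝ) ≤ M (j + 1) := by exact_mod_cast h.degree_mono j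
  obtain ⟨b, c, hb, hc, hcj, hbM, hinv⟩ := h.invert _ _ hU' hj
  set δ : V → ℝ := fun v => 1 - ∑ T ∈ edgesAt H (U \ S) v, x T with hδ
  have hδ' : ∀ v ∈ U \ S, δ v = ∑ T ∈ edgesAt H (U \ S) v, ((M j : ℝ)⁻¹ - x T) := by
    intro v hv
    rw [sum_sub_distrib, sum_const, h.degree _ _ v hU' hv, nsmul_eq_mul,
      mul_inv_cancel₀ hMj.ne']
  have hinv' := hinv _ δ hδ'
  set D := ∑ u ∈ U \ S, δ u with hD
  set d : ℝ := k * β / (j + 1) with hd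
  have hd0 : 0 ≤ d := by positivity
  have hδb : ∀ v ∈ U \ S, 0 ≤ δ v ∧ δ v ≤ d := by
    intro v hv
    have := h.one_sub_degree_le hk (by omega) hU (by linarith) hx hS hv
    push_cast at this
    exact this
  have hD0 : 0 ≤ D := sum_nonneg fun v hv => (hδb v hv).1
  have hDle : D ≤ k * j * d := by
    have := sum_le_card_nsmul (U \ S) δ d fun v hv => (hδb v hv).2
    rwa [nsmul_eq_mul, hcard] at this
  have hDk : D ≤ k * (k - 1) := by
    have e1 : D = k * j - k * ∑ T ∈ edgesIn H (U \ S), x T := by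
      rw [hD, hδ, sum_sub_distrib, sum_const, nsmul_eq_mul, hcard, mul_one]
      have := sum_sum_edgesAt H (U \ S) x (fun _ => 1)
      simp only [one_mul, sum_const, nsmul_eq_mul, mul_one] at this
      rw [this, mul_sum]
      congr 1
      refine Finset.sum_congr rfl fun T hT => ?_
      rw [h.card_edge T (mem_edgesIn.1 hT).1, mul_comm]
    have e2 := h.le_surviving hk hU hx hS
    push_cast at e2
    rw [e1]
    nlinarith
  have hsub : ∀ T ∈ edgesIn H (U \ S), T ∈ edgesIn H U := fun T hT =>
    mem_edgesIn.2 ⟨(mem_edgesIn.1 hT).1, (mem_edgesIn.1 hT).2.trans sdiff_subset⟩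
  have hδT : ∀ T ∈ edgesIn H (U \ S), 0 ≤ ∑ u ∈ T, δ u ∧ ∑ u ∈ T, δ u ≤ k * d := by
    intro T hT
    rw [mem_edgesIn] at hT
    refine ⟨sum_nonneg fun v hv => (hδb v (hT.2 hv)).1, ?_⟩
    have := sum_le_card_nsmul T δ d fun v hv => (hδb v (hT.2 hv)).2
    rwa [nsmul_eq_mul, h.card_edge T hT.1] at this
  have hcD : c * D ≤ k * d := by
    have hkj : (k : ℝ) ≤ k * j := le_mul_of_one_le_right (by linarith) hj1'
    have hc1 : c ≤ 1 := by
      refine le_of_mul_le_mul_right (a := (k * j - 1 : ℝ)) ?_ (by linarith)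
      linarith
    have : c * (k * j) ≤ k := by linarith
    calc c * D ≤ c * (k * j * d) := by gcongr
      _ = c * (k * j) * d := by ring
      _ ≤ k * d := by gcongr
  have hxT : ∀ T ∈ edgesIn H (U \ S), 0 < x T ∧ 1 ≤ β * M (j + 1) * x T := fun T hT =>
    ⟨hx.pos T (hsub T hT), h.one_le_mul_weight hk (by omega) hU hx (hsub T hT)⟩
  refine ⟨fun T => x T + (∑ u ∈ T, δ u - c * D) / b, ?_, ?_, ?_⟩
  · intro T hT
    obtain ⟨hx0, hx1⟩ := hxT T hT
    have h1 : c * D ≤ b * x T := by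
      have g1 : (k : ℝ) ≤ b * x T * (β * (k + 1)) := by
        have : (k : ℝ) * M (j + 1) * (β * x T) ≤ (k + 1) * b * (β * x T) := by gcongr
        nlinarith
      have g2 : β * ((k + 1) * (k - 1) ^ 2) ≤ k * j - 1 := by
        have g3 : (k + 1 : ℝ) * (k - 1) ^ 2 ≤ (k : ℝ) ^ 3 - 1 := by nlinarith
        have g4 : β * ((k + 1) * (k - 1) ^ 2) ≤ β * ((k : ℝ) ^ 3 - 1) := by gcongr
        nlinarith
      have hq : (0 : ℝ) < k * j - 1 := by nlinarith
      have g5 : c * D * (β * (k + 1)) ≤ k := by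
        refine le_of_mul_le_mul_right ?_ hq
        calc c * D * (β * (k + 1)) * (k * j - 1)
            = (c * (k * j - 1)) * D * (β * (k + 1)) := by ring
          _ ≤ (k - 1) * (k * (k - 1)) * (β * (k + 1)) := by
            have : (0 : ℝ) ≤ k - 1 := by linarith
            gcongr
          _ = k * (β * ((k + 1) * (k - 1) ^ 2)) := by ring
          _ ≤ k * (k * j - 1) := by gcongr
      exact le_of_mul_le_mul_right (g5.trans g1) (by positivity)
    have h2 : -x T ≤ (∑ u ∈ T, δ u - c * D) / b := by
      rw [le_div_iff₀ hb]
      nlinarith [(hδT T hT).1]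
    linarith
  · intro v hv
    rw [sum_add_distrib, ← sum_div, sum_sub_distrib, hinv' v hv, sum_const,
      h.degree _ _ v hU' hv, nsmul_eq_mul, add_sub_cancel_right, mul_div_cancel_left₀ _ hb.ne']
    simp [hδ]
  · have hterm : ∀ T ∈ edgesIn H (U \ S),
        (x T + (∑ u ∈ T, δ u - c * D) / b - x T) ^ 2 / x T ≤
          β * M (j + 1) * (k * d / b) ^ 2 := by
      intro T hT
      obtain ⟨hx0, hx1⟩ := hxT T hT
      rw [add_sub_cancel_left, div_le_iff₀ hx0]
      have h1 : ((∑ u ∈ T, δ u - c * D) / b) ^ 2 ≤ (k * d / b) ^ 2 := by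
        rw [div_pow, div_pow]
        refine div_le_div_of_nonneg_right ?_ (by positivity)
        have := hδT T hT
        have := mul_nonneg hc hD0
        exact sq_le_sq' (by linarith) (by linarith)
      nlinarith [sq_nonneg (k * d / b)]
    have hsum := sum_le_card_nsmul _ _ _ hterm
    rw [nsmul_eq_mul, h.card_edgesIn hk hj1 hU'] at hsum
    refine hsum.trans ?_
    have hb2 : (k : ℝ) * M (j + 1) / b ≤ k + 1 := by rwa [div_le_iff₀ hb]
    calc (j : ℝ) * M j * (β * M (j + 1) * (k * d / b) ^ 2)
        ≤ j * M (j + 1) * (β * M (j + 1) * (k * d / b) ^ 2) := by gcongr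
      _ = β * j * d ^ 2 * (k * M (j + 1) / b) ^ 2 := by ring
      _ ≤ β * j * d ^ 2 * (k + 1) ^ 2 := by gcongr
      _ = β ^ 3 * ((k : ℝ) ^ 2 + k) ^ 2 * (j / (j + 1) ^ 2) := by
        rw [hd]
        field_simp
      _ ≤ β ^ 3 * ((k : ℝ) ^ 2 + k) ^ 2 * (1 / (j + 1)) := by
        refine mul_le_mul_of_nonneg_left ?_ (by positivity)
        rw [div_le_div_iff₀ (by positivity) (by positivity)]
        nlinarith
      _ = _ := by ring

end

end Homogeneous

/-! ### Induction on the number of edges in a matching -/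

namespace Homogeneous

variable {V ι : Type*} [DecidableEq V] {k : ℕ} {H : Finset (Finset V)}
  {Lev : Finset V → ℕ → Prop} {M : ℕ → ℕ} {r : V → ι}

/-- Passing from one scaling of the weight on `U` to another changes the scaled partition
function by the exponential of the sum of the logarithms of the ratios of the multipliers. -/
lemma exists_log_ratio {U : Finset V} {w : Finset V → ℝ} {lam mu : V → ℝ}
    (hl : ∀ v ∈ U, 0 < lam v) (hm : IsScaling H w U mu) :
    ∃ ζ : V → ℝ, (∀ v ∈ U, ∑ T ∈ edgesAt H U v,
        scaled w lam T * Real.exp (∑ u ∈ T, ζ u) = 1) ∧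
      matchSum H (scaled w lam) U =
        matchSum H (scaled w mu) U * Real.exp (-∑ v ∈ U, ζ v) := by
  have hexp : ∀ T ⊆ U, Real.exp (∑ u ∈ T, Real.log (mu u / lam u)) =
      (∏ u ∈ T, mu u) / ∏ u ∈ T, lam u := by
    intro T hT
    rw [Real.exp_sum, ← prod_div_distrib]
    exact prod_congr rfl fun u hu =>
      Real.exp_log (div_pos (hm.pos u (hT hu)) (hl u (hT hu)))
  have hne : ∀ T ⊆ U, ∏ u ∈ T, lam u ≠ 0 := fun T hT =>
    (prod_pos fun u hu => hl u (hT hu)).ne'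
  refine ⟨fun v => Real.log (mu v / lam v), fun v hv => ?_, ?_⟩
  · rw [← hm.sum_eq_one v hv]
    refine Finset.sum_congr rfl fun T hT => ?_
    have hTU := (mem_edgesAt.1 hT).1.2
    rw [hexp T hTU, scaled, scaled]
    have := hne T hTU
    field_simp
  · have h1 := hne U subset_rfl
    have h2 : ∏ u ∈ U, mu u ≠ 0 := (prod_pos fun u hu => hm.pos u hu).ne'
    rw [matchSum_scaled, matchSum_scaled, Real.exp_neg, hexp U subset_rfl]
    field_simp

lemma matchSum_nonneg {U : Finset V} {x : Finset V → ℝ} (hx : ∀ S ∈ edgesIn H U, 0 ≤ x S) :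
    0 ≤ matchSum H x U := by
  refine sum_nonneg fun N hN => prod_nonneg fun S hS => hx S ?_
  obtain ⟨h1, -, h3⟩ := mem_matchings.1 hN
  rw [mem_edgesIn, ← h3]
  exact ⟨h1 hS, fun v hv => mem_biUnion.2 ⟨S, hS, hv⟩⟩

section

variable {α : ℝ} {w : Finset V → ℝ}

lemma matchSum_succ_le (h : Homogeneous k H Lev M r) (hk : 1 < k) {U : Finset V} {j : ℕ}
    (hj : 1 ≤ j) (hU : Lev U (j + 1)) (hα : 1 ≤ α) (hw : IsBalanced α H w) {lam : V → ℝ}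
    (hl : IsScaling H w U lam) {K : ℝ} (hK0 : 0 ≤ K)
    (hK : ∀ U' mu, Lev U' j → IsScaling H w U' mu → matchSum H (scaled w mu) U' ≤ K) :
    matchSum H (scaled w lam) U ≤
      K * Real.exp (-((k : ℝ) - 1) + gammaUpper k α / (j + 1)) := by
  have hx := h.isBalancedStochastic_scaled (by omega) hU hα hw hl
  obtain ⟨v, hv⟩ := h.level_nonempty hk (by omega) hU
  rw [matchSum_eq_sum_edgesAt H _ hv]
  have hstep : ∀ S ∈ edgesAt H U v, scaled w lam S * matchSum H (scaled w lam) (U \ S) ≤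
      scaled w lam S * (K * Real.exp (-((k : ℝ) - 1) + gammaUpper k α / (j + 1))) := by
    intro S hS
    have hSE : S ∈ edgesIn H U := (mem_filter.1 hS).1
    have hU' := h.level_sdiff U j S hU hSE
    refine mul_le_mul_of_nonneg_left ?_ (hx.pos S hSE).le
    obtain ⟨mu, hmu⟩ := h.exists_isScaling hj hU' hw.1
    obtain ⟨ζ, hζ, hmatch⟩ := exists_log_ratio
      (fun u hu => hl.pos u (sdiff_subset hu)) hmu
    rw [hmatch]
    refine mul_le_mul (hK _ _ hU' hmu) (Real.exp_le_exp.2 ?_) (Real.exp_pos _).le hK0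
    have h1 := h.sub_le_sum_log_multiplier hk hU' (fun T hT => hx.pos T (mem_edgesIn.2
      ⟨(mem_edgesIn.1 hT).1, (mem_edgesIn.1 hT).2.trans sdiff_subset⟩)) hζ
    have h2 := h.surviving_le hk (by omega) hU (by positivity) hx hSE
    push_cast at h2
    rw [gammaUpper]
    linarith
  refine (sum_le_sum hstep).trans ?_
  rw [← sum_mul, hl.sum_eq_one v hv, one_mul]

lemma le_matchSum_succ (h : Homogeneous k H Lev M r) (hk : 1 < k) {U : Finset V} {j : ℕ}
    (hj : 4 * k ^ 2 ≤ j) (hjα : α ^ (k + 1) * k ^ 2 ≤ j) (hU : Lev U (j + 1)) (hα : 1 ≤ α)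
    (hw : IsBalanced α H w) {lam : V → ℝ} (hl : IsScaling H w U lam) {K : ℝ} (hK0 : 0 ≤ K)
    (hK : ∀ U' mu, Lev U' j → IsScaling H w U' mu → K ≤ matchSum H (scaled w mu) U') :
    K * Real.exp (-((k : ℝ) - 1) - α ^ (3 * (k + 1)) * ((k : ℝ) ^ 2 + k) ^ 2 / (j + 1)) ≤
      matchSum H (scaled w lam) U := by
  have hj1 : 1 ≤ j := by nlinarith
  have hx := h.isBalancedStochastic_scaled (by omega) hU hα hw hl
  obtain ⟨v, hv⟩ := h.level_nonempty hk (by omega) hU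
  rw [matchSum_eq_sum_edgesAt H _ hv]
  set L := Real.exp (-((k : ℝ) - 1) - α ^ (3 * (k + 1)) * ((k : ℝ) ^ 2 + k) ^ 2 / (j + 1))
  have hstep : ∀ S ∈ edgesAt H U v, scaled w lam S * (K * L) ≤
      scaled w lam S * matchSum H (scaled w lam) (U \ S) := by
    intro S hS
    have hSE : S ∈ edgesIn H U := (mem_filter.1 hS).1
    have hU' := h.level_sdiff U j S hU hSE
    refine mul_le_mul_of_nonneg_left ?_ (hx.pos S hSE).le
    obtain ⟨mu, hmu⟩ := h.exists_isScaling hj1 hU' hw.1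
    obtain ⟨ζ, hζ, hmatch⟩ := exists_log_ratio
      (fun u hu => hl.pos u (sdiff_subset hu)) hmu
    rw [hmatch]
    refine mul_le_mul (hK _ _ hU' hmu) (Real.exp_le_exp.2 ?_) (Real.exp_pos _).le
      (hK0.trans (hK _ _ hU' hmu))
    obtain ⟨y, hy0, hy1, hyx⟩ := h.exists_stochastic_near hk hj (one_le_pow₀ hα) hjα hU hx hSE
    have h1 := h.sum_log_multiplier_le hk hU' (fun T hT => hx.pos T (mem_edgesIn.2
      ⟨(mem_edgesIn.1 hT).1, (mem_edgesIn.1 hT).2.trans sdiff_subset⟩)) hζ hy0 hy1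
    have h2 := h.le_surviving hk hU hx hSE
    push_cast at h2
    rw [← pow_mul, mul_comm (k + 1) 3] at hyx
    linarith
  refine le_trans ?_ (sum_le_sum hstep)
  rw [← sum_mul, hl.sum_eq_one v hv, one_mul]

lemma matchSum_level_one (h : Homogeneous k H Lev M r) (hk : 1 < k) {U : Finset V}
    (hU : Lev U 1) {lam : V → ℝ} (hl : IsScaling H w U lam) :
    matchSum H (scaled w lam) U = 1 := by
  obtain ⟨v, hv⟩ := h.level_nonempty hk le_rfl hU
  rw [matchSum_eq_sum_edgesAt H _ hv, ← hl.sum_eq_one v hv]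
  refine Finset.sum_congr rfl fun S hS => ?_
  have h0 := h.card_level _ _ (h.level_sdiff U 0 S hU (mem_filter.1 hS).1)
  rw [mul_zero, card_eq_zero] at h0
  rw [h0, matchSum_empty (h.edge_nonempty hk), mul_one]

lemma inv_succ_le_log_sub_log {j : ℕ} (hj : 1 ≤ j) :
    1 / ((j : ℝ) + 1) ≤ Real.log (j + 1) - Real.log j := by
  have hj0 : (0 : ℝ) < j := by exact_mod_cast hj
  have := Real.one_sub_inv_le_log_of_pos (x := ((j : ℝ) + 1) / j) (by positivity)
  rw [Real.log_div (by positivity) hj0.ne'] at this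
  refine le_trans (le_of_eq ?_) this
  field_simp
  ring

/-- A Bregman–Minc type bound. -/
lemma matchSum_le (h : Homogeneous k H Lev M r) (hk : 1 < k) (hα : 1 ≤ α)
    (hw : IsBalanced α H w) {j : ℕ} (hj : 1 ≤ j) :
    ∀ U lam, Lev U j → IsScaling H w U lam → matchSum H (scaled w lam) U ≤
      Real.exp (-((k : ℝ) - 1) * (j - 1) + gammaUpper k α * Real.log j) := by
  induction j, hj using Nat.le_induction with
  | base =>
    intro U lam hU hl
    simp [h.matchSum_level_one hk hU hl]
  | succ j hj ih =>
    intro U lam hU hl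
    refine (h.matchSum_succ_le hk hj hU hα hw hl (Real.exp_pos _).le ih).trans ?_
    rw [← Real.exp_add, Real.exp_le_exp]
    have hg : 0 ≤ gammaUpper k α := by unfold gammaUpper; positivity
    have := mul_le_mul_of_nonneg_left (inv_succ_le_log_sub_log hj) hg
    push_cast
    rw [mul_one_div] at this
    linarith

/-- A van der Waerden type bound, relative to a bound at a sufficiently large level. -/
lemma le_matchSum_of_le (h : Homogeneous k H Lev M r) (hk : 1 < k) (hα : 1 ≤ α)
    (hw : IsBalanced α H w) {l : ℕ} (hl4 : 4 * k ^ 2 ≤ l) (hlα : α ^ (k + 1) * k ^ 2 ≤ l)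
    {K : ℝ} (hK0 : 0 ≤ K)
    (hK : ∀ U mu, Lev U l → IsScaling H w U mu → K ≤ matchSum H (scaled w mu) U)
    {j : ℕ} (hj : l ≤ j) :
    ∀ U lam, Lev U j → IsScaling H w U lam →
      K * Real.exp (-((k : ℝ) - 1) * (j - l) -
        α ^ (3 * (k + 1)) * ((k : ℝ) ^ 2 + k) ^ 2 * Real.log j) ≤
      matchSum H (scaled w lam) U := by
  set C : ℝ := α ^ (3 * (k + 1)) * ((k : ℝ) ^ 2 + k) ^ 2 with hC
  have hC0 : 0 ≤ C := by positivity
  induction j, hj using Nat.le_induction with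
  | base =>
    intro U lam hU hl
    refine le_trans ?_ (hK U lam hU hl)
    refine mul_le_of_le_one_right hK0 (Real.exp_le_one_iff.2 ?_)
    have : 0 ≤ C * Real.log l := mul_nonneg hC0 (Real.log_natCast_nonneg l)
    simp only [sub_self, mul_zero]
    linarith
  | succ j hj ih =>
    intro U lam hU hl
    have hlj : (l : ℝ) ≤ j := by exact_mod_cast hj
    refine le_trans ?_ (h.le_matchSum_succ hk (hl4.trans hj) (hlα.trans hlj) hU hα hw hl
      (mul_nonneg hK0 (Real.exp_pos _).le) ih)
    rw [mul_assoc K, ← Real.exp_add]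
    refine mul_le_mul_of_nonneg_left (Real.exp_le_exp.2 ?_) hK0
    have hj1 : 1 ≤ j := by nlinarith
    have := mul_le_mul_of_nonneg_left (inv_succ_le_log_sub_log hj1) hC0
    push_cast
    rw [mul_one_div] at this
    rw [← hC]
    linarith

end

/-! ### The crude lower bound at small levels -/

/-- Induced sub-hypergraphs of level `j` have a perfect matching, of weight at least `c ^ j`. -/
lemma pow_le_matchSum (h : Homogeneous k H Lev M r) (hk : 1 < k) {x : Finset V → ℝ} {c : ℝ}
    (hc : 0 ≤ c) {j : ℕ} : ∀ U, Lev U j → (∀ S ∈ edgesIn H U, c ≤ x S) →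
      c ^ j ≤ matchSum H x U := by
  induction j with
  | zero =>
    intro U hU _
    have h0 := h.card_level _ _ hU
    rw [mul_zero, card_eq_zero] at h0
    rw [h0, matchSum_empty (h.edge_nonempty hk), pow_zero]
  | succ j ih =>
    intro U hU hx
    obtain ⟨v, hv⟩ := h.level_nonempty hk (by omega) hU
    have hM := h.degree_pos (j + 1) (by omega)
    rw [← h.degree U _ v hU hv, card_pos] at hM
    obtain ⟨S, hS⟩ := hM
    have hsub : ∀ S T, T ∈ edgesIn H (U \ S) → T ∈ edgesIn H U := fun S T hT =>
      mem_edgesIn.2 ⟨(mem_edgesIn.1 hT).1, (mem_edgesIn.1 hT).2.trans sdiff_subset⟩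
    have hSE : S ∈ edgesIn H U := (mem_filter.1 hS).1
    rw [matchSum_eq_sum_edgesAt H _ hv, pow_succ']
    refine le_trans ?_ (single_le_sum (f := fun S => x S * matchSum H x (U \ S)) ?_ hS)
    · exact mul_le_mul (hx S hSE) (ih _ (h.level_sdiff U j S hU hSE)
        fun T hT => hx T (hsub S T hT)) (by positivity) (hc.trans (hx S hSE))
    · intro T hT
      exact mul_nonneg (hc.trans (hx T (mem_filter.1 hT).1))
        (matchSum_nonneg fun T' hT' => hc.trans (hx T' (hsub T T' hT')))

/-- Every edge through a fixed vertex extends to a perfect matching, and all weights are at least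
`1 / (β * M (j + 1))`. -/
lemma inv_pow_mul_inv_pow_le_matchSum (h : Homogeneous k H Lev M r) (hk : 1 < k) {x : Finset V → ℝ}
    {β : ℝ} (hβ : 0 < β) {j : ℕ} {U : Finset V} (hU : Lev U (j + 1))
    (hx : IsBalancedStochastic β H U x) :
    ((β ^ (j + 1))⁻¹ * ((M (j + 1) : ℝ) ^ j)⁻¹) ≤ matchSum H x U := by
  have hM : (0 : ℝ) < M (j + 1) := by exact_mod_cast h.degree_pos (j + 1) (by omega)
  have hc : ∀ S ∈ edgesIn H U, (β * M (j + 1))⁻¹ ≤ x S := by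
    intro S hS
    rw [inv_le_iff_one_le_mul₀ (by positivity), mul_comm]
    exact h.one_le_mul_weight hk (by omega) hU hx hS
  have hc0 : 0 ≤ (β * M (j + 1))⁻¹ := by positivity
  obtain ⟨v, hv⟩ := h.level_nonempty hk (by omega) hU
  rw [matchSum_eq_sum_edgesAt H _ hv]
  have hstep := card_nsmul_le_sum (edgesAt H U v) (fun S => x S * matchSum H x (U \ S))
    ((β * M (j + 1))⁻¹ * (β * M (j + 1))⁻¹ ^ j) fun S hS => ?_
  · rw [nsmul_eq_mul, h.degree U _ v hU hv] at hstep
    refine le_trans (le_of_eq ?_) hstep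
    rw [inv_pow, mul_pow, pow_succ]
    field_simp
  · have hSE : S ∈ edgesIn H U := (mem_filter.1 hS).1
    exact mul_le_mul (hc S hSE) (h.pow_le_matchSum hk hc0 _ (h.level_sdiff U j S hU hSE)
      fun T hT => hc T (mem_edgesIn.2
        ⟨(mem_edgesIn.1 hT).1, (mem_edgesIn.1 hT).2.trans sdiff_subset⟩))
      (by positivity) (hx.pos S hSE).le

end Homogeneous

/-! ### The bounds with explicit constants -/

/-- With `l = n + 1`, `epsLower` is `l` times the crude lower bound at level `l`. -/
lemma epsLower_eq {k : ℕ} (hk : 1 < k) {α : ℝ} (hα : 1 ≤ α) {n : ℕ} (hn : ell k α = n + 1) :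
    epsLower k α = ((α ^ (k + 1)) ^ (n + 1))⁻¹ * (n + 1) *
      (((k * (n + 1) - 1).choose (k - 1) : ℝ) ^ n)⁻¹ := by
  have hkl : k ≤ k * (n + 1) := Nat.le_mul_of_pos_right _ (by omega)
  have h1 : (k * (n + 1)).choose k = (n + 1) * (k * (n + 1) - 1).choose (k - 1) := by
    have := Nat.add_one_mul_choose_eq (k * (n + 1) - 1) (k - 1)
    rw [Nat.sub_add_cancel (by omega), Nat.sub_add_cancel (by omega)] at this
    refine Nat.eq_of_mul_eq_mul_right (show 0 < k by omega) ?_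
    rw [← this]
    ring
  have hA : (0 : ℝ) < (k * (n + 1) - 1).choose (k - 1) := by
    exact_mod_cast Nat.choose_pos (by omega)
  have hα0 : α ≠ 0 := by positivity
  have e1 : (1 - ((n + 1 : ℕ) : ℤ)) = -(n : ℤ) := by push_cast; ring
  have e2 : (-(((k : ℤ) + 1) * ((n + 1 : ℕ) : ℤ))) = -(((k + 1) * (n + 1) : ℕ) : ℤ) := by
    push_cast; ring
  rw [epsLower, hn, e1, e2, zpow_neg, zpow_neg, zpow_natCast, zpow_natCast, h1, ← pow_mul]
  push_cast
  rw [mul_pow, pow_succ (n + 1 : ℝ) n]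
  field_simp

lemma add_one_le_exp_mul {k : ℕ} (hk : 1 < k) (n : ℕ) :
    (n + 1 : ℝ) ≤ Real.exp ((n + 1) * ((k : ℝ) - 1)) := by
  have hk1 : (2 : ℝ) ≤ k := by exact_mod_cast hk
  have := Real.add_one_le_exp ((n + 1 : ℝ) * ((k : ℝ) - 1))
  nlinarith

namespace Homogeneous

variable {V ι : Type*} [DecidableEq V] {k : ℕ} {H : Finset (Finset V)}
  {Lev : Finset V → ℕ → Prop} {M : ℕ → ℕ} {r : V → ι} {α : ℝ} {w : Finset V → ℝ}

lemma matchSum_le_epsUpper (h : Homogeneous k H Lev M r) (hk : 1 < k) (hα : 1 ≤ α)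
    (hw : IsBalanced α H w) {m : ℕ} (hm : 1 < m) {U : Finset V} (hU : Lev U m) {lam : V → ℝ}
    (hl : IsScaling H w U lam) :
    matchSum H (scaled w lam) U ≤ epsUpper k α * (m : ℝ) ^ gammaUpper k α *
      Real.exp (-((m : ℝ) * ((k : ℝ) - 1))) := by
  have hk1 : (2 : ℝ) ≤ k := by exact_mod_cast hk
  have hm0 : (0 : ℝ) < m := by positivity
  refine (h.matchSum_le hk hα hw (by omega) U lam hU hl).trans ?_
  rw [Real.rpow_def_of_pos hm0, epsUpper, ← Real.exp_add, ← Real.exp_add, Real.exp_le_exp]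
  have hl1 : (1 : ℝ) ≤ ell k α := by
    rw [ell]; push_cast; linarith [Nat.cast_nonneg (α := ℝ) ⌈α ^ (2 * (k + 1)) * (k : ℝ) ^ 2⌉₊]
  nlinarith

lemma epsLower_le_matchSum (h : Homogeneous k H Lev M r) (hk : 1 < k) (hα : 1 ≤ α)
    (hα2 : 2 < α ^ (k + 1)) (hw : IsBalanced α H w) {m : ℕ} (hm : 1 < m) {U : Finset V}
    (hU : Lev U m) {lam : V → ℝ} (hl : IsScaling H w U lam) :
    epsLower k α * (m : ℝ) ^ (-gammaLower k α) * Real.exp (-((m : ℝ) * ((k : ℝ) - 1))) ≤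
      matchSum H (scaled w lam) U := by
  have hk1 : (2 : ℝ) ≤ k := by exact_mod_cast hk
  have hm1 : (1 : ℝ) < m := by exact_mod_cast hm
  have hm0 : (0 : ℝ) < m := by linarith
  have hlog : 0 ≤ Real.log m := Real.log_natCast_nonneg m
  set β := α ^ (k + 1) with hβ
  have hβ1 : 1 ≤ β := one_le_pow₀ hα
  have hβ0 : 0 < β := by linarith
  set n := ⌈α ^ (2 * (k + 1)) * (k : ℝ) ^ 2⌉₊ with hn
  have hln : ell k α = n + 1 := rfl
  have hnge : β ^ 2 * (k : ℝ) ^ 2 ≤ n := by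
    rw [hβ, ← pow_mul, mul_comm (k + 1) 2]
    exact Nat.le_ceil _
  set A : ℝ := (((k * (n + 1) - 1).choose (k - 1) : ℕ) : ℝ) with hA
  have hnA : (n : ℝ) + 1 ≤ A := by
    have h1 : (n + 1).choose n ≤ (n + (k - 1)).choose n := Nat.choose_le_choose _ (by omega)
    rw [Nat.choose_succ_self_right, Nat.choose_symm_add] at h1
    have hkn : n ≤ k * n := Nat.le_mul_of_pos_left _ (by omega)
    have h2 : (n + (k - 1)).choose (k - 1) ≤ (k * (n + 1) - 1).choose (k - 1) :=
      Nat.choose_le_choose _ (by rw [mul_add, mul_one]; omega)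
    rw [hA]
    exact_mod_cast h1.trans h2
  have hA1 : 1 ≤ A := by linarith [Nat.cast_nonneg (α := ℝ) n]
  have hA0 : 0 < A := by linarith
  -- the crude bound at levels up to `ell k α`
  have hbase : ∀ j ≤ n, 1 ≤ j → ∀ U mu, Lev U (j + 1) → IsScaling H w U mu →
      (β ^ (n + 1))⁻¹ * (A ^ j)⁻¹ ≤ matchSum H (scaled w mu) U := by
    intro j hj hj1 U mu hU hmu
    have hx := h.isBalancedStochastic_scaled (by omega) hU hα hw hmu
    refine le_trans ?_ (h.inv_pow_mul_inv_pow_le_matchSum hk hβ0 hU hx)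
    have hM0 : (0 : ℝ) < M (j + 1) := by exact_mod_cast h.degree_pos (j + 1) (by omega)
    have hMA : (M (j + 1) : ℝ) ≤ A := by
      have h1 := h.degree_le hk (by omega) hU
      have h2 : (k * (j + 1) - 1).choose (k - 1) ≤ (k * (n + 1) - 1).choose (k - 1) :=
        Nat.choose_le_choose _ (Nat.sub_le_sub_right (Nat.mul_le_mul_left k (by omega)) 1)
      rw [hA]
      exact_mod_cast h1.trans h2
    gcongr
  have hpow : (m : ℝ) ^ (-gammaLower k α) = Real.exp (-gammaLower k α * Real.log m) := by
    rw [Real.rpow_def_of_pos hm0, mul_comm]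
  have hg : α ^ (3 * (k + 1)) * ((k : ℝ) ^ 2 + k) ^ 2 ≤ gammaLower k α := by
    rw [gammaLower]
    nlinarith [sq_nonneg ((k : ℝ) - 1)]
  have hg0 : 0 ≤ gammaLower k α := le_trans (by positivity) hg
  rw [epsLower_eq hk hα hln, ← hβ, ← hA, hpow]
  rcases Nat.lt_or_ge n m with hnm | hnm
  · have hn1 : 1 ≤ n := by
      have : (0 : ℝ) < n := lt_of_lt_of_le (by positivity) hnge
      exact_mod_cast this
    have hn4 : 4 * k ^ 2 ≤ n + 1 := by
      have : (4 : ℝ) * k ^ 2 ≤ n + 1 := by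
        have : (4 : ℝ) * k ^ 2 ≤ β ^ 2 * k ^ 2 := by
          gcongr
          nlinarith
        linarith
      exact_mod_cast this
    have hnβ : β * (k : ℝ) ^ 2 ≤ ((n + 1 : ℕ) : ℝ) := by
      have : β * (k : ℝ) ^ 2 ≤ β ^ 2 * k ^ 2 := by
        gcongr
        nlinarith
      push_cast
      linarith
    refine le_trans ?_ (h.le_matchSum_of_le hk hα hw hn4 hnβ (by positivity)
      (hbase n le_rfl hn1) hnm U lam hU hl)
    calc (β ^ (n + 1))⁻¹ * (n + 1) * (A ^ n)⁻¹ * Real.exp (-gammaLower k α * Real.log m) *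
          Real.exp (-((m : ℝ) * ((k : ℝ) - 1)))
        = (β ^ (n + 1))⁻¹ * (A ^ n)⁻¹ * ((n + 1) *
          Real.exp (-gammaLower k α * Real.log m + -((m : ℝ) * ((k : ℝ) - 1)))) := by
          rw [Real.exp_add]; ring
      _ ≤ (β ^ (n + 1))⁻¹ * (A ^ n)⁻¹ * (Real.exp ((n + 1) * ((k : ℝ) - 1)) *
          Real.exp (-gammaLower k α * Real.log m + -((m : ℝ) * ((k : ℝ) - 1)))) := by
          gcongr
          exact add_one_le_exp_mul hk n
      _ ≤ _ := by
          rw [← Real.exp_add]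
          refine mul_le_mul_of_nonneg_left (Real.exp_le_exp.2 ?_) (by positivity)
          have := mul_le_mul_of_nonneg_right hg hlog
          push_cast
          linarith
  · obtain ⟨j, rfl⟩ : ∃ j, m = j + 1 := ⟨m - 1, by omega⟩
    refine le_trans ?_ (hbase j (by omega) (by omega) U lam hU hl)
    have h1 : Real.exp (-gammaLower k α * Real.log ((j + 1 : ℕ) : ℝ)) ≤ 1 :=
      Real.exp_le_one_iff.2 (by nlinarith)
    have h2 : Real.exp (-(((j + 1 : ℕ) : ℝ) * ((k : ℝ) - 1))) ≤ 1 :=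
      Real.exp_le_one_iff.2 (by nlinarith)
    have h3 : (n + 1 : ℝ) * (A ^ n)⁻¹ ≤ (A ^ j)⁻¹ := by
      rw [← div_eq_mul_inv, div_le_iff₀ (by positivity), inv_mul_eq_div, le_div_iff₀ (by positivity)]
      calc (n + 1 : ℝ) * A ^ j ≤ A * A ^ j := by gcongr
        _ = A ^ (j + 1) := by ring
        _ ≤ A ^ n := pow_le_pow_right₀ hA1 hnm
    calc (β ^ (n + 1))⁻¹ * (n + 1) * (A ^ n)⁻¹ *
          Real.exp (-gammaLower k α * Real.log ((j + 1 : ℕ) : ℝ)) *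
          Real.exp (-(((j + 1 : ℕ) : ℝ) * ((k : ℝ) - 1)))
        ≤ (β ^ (n + 1))⁻¹ * (n + 1) * (A ^ n)⁻¹ * 1 * 1 := by gcongr
      _ = (β ^ (n + 1))⁻¹ * ((n + 1) * (A ^ n)⁻¹) := by ring
      _ ≤ _ := by gcongr

end Homogeneous

/-! ### Complete uniform hypergraphs are homogeneous -/

section

variable {V : Type*} [DecidableEq V]

lemma sum_edgesAt_sum (H : Finset (Finset V)) (U : Finset V) (v : V) (δ : V → ℝ) :
    ∑ T ∈ edgesAt H U v, ∑ u ∈ T, δ u =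
      ∑ u ∈ U, ((edgesAt H U v).filter (u ∈ ·)).card * δ u := by
  simp_rw [card_filter]
  push_cast
  simp_rw [sum_mul]
  rw [sum_comm]
  refine Finset.sum_congr rfl fun T hT => ?_
  simp only [ite_mul, one_mul, zero_mul]
  rw [← sum_filter, filter_mem_eq_inter, inter_eq_right.2 (mem_edgesAt.1 hT).1.2]

lemma edgesAt_filter_of_isCompleteUniform {k : ℕ} {H : Finset (Finset V)}
    (hH : IsCompleteUniform k H) (U : Finset V) (u v : V) :
    (edgesAt H U u).filter (v ∈ ·) = (powersetCard k U).filter (({u, v} : Finset V) ⊆ ·) := by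
  ext T
  rw [mem_filter, mem_edgesAt, mem_filter, mem_powersetCard, hH T, insert_subset_iff,
    singleton_subset_iff]
  tauto

end

/-- A Bernoulli-type bound for the ratio of the binomial coefficients `(n + i).choose s` and
`n.choose s`. -/
lemma choose_add_mul_le (n s i : ℕ) :
    ((n + i).choose s : ℝ) * (n - i * s) ≤ n.choose s * n := by
  induction i with
  | zero => simp
  | succ i ih =>
    have h1 : ((n + i + 1).choose s : ℝ) * (n + i + 1 - s) = (n + i).choose s * (n + i + 1) := by
      rcases Nat.lt_or_ge (n + i + 1) s with hs | hs
      · rw [Nat.choose_eq_zero_of_lt hs, Nat.choose_eq_zero_of_lt (by omega)]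
        simp
      · have := Nat.choose_mul_succ_eq (n + i) s
        have h2 : (((n + i + 1 - s : ℕ)) : ℝ) = n + i + 1 - s := by
          rw [Nat.cast_sub hs]; push_cast; ring
        rw [← h2]
        have h3 : ((n + i).choose s * (n + i + 1) : ℕ) =
          ((n + i + 1).choose s * (n + i + 1 - s) : ℕ) := this
        exact_mod_cast h3.symm
    have hpos : (0 : ℝ) < n + i + 1 := by positivity
    refine le_of_mul_le_mul_right ?_ hpos
    have hc : (0 : ℝ) ≤ (n + i + 1).choose s := by positivity
    have h4 : ((n : ℝ) - (i + 1) * s) * (n + i + 1) ≤ (n - i * s) * (n + i + 1 - s) := by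
      have : (0 : ℝ) ≤ s := by positivity
      have hi : (0 : ℝ) ≤ i := by positivity
      nlinarith [mul_nonneg hi this, mul_nonneg (mul_nonneg hi this) this,
        mul_nonneg hi (mul_nonneg this hi)]
    push_cast
    rw [← add_assoc]
    calc ((n + i + 1).choose s : ℝ) * (n - (i + 1) * s) * (n + i + 1)
        = (n + i + 1).choose s * ((n - (i + 1) * s) * (n + i + 1)) := by ring
      _ ≤ (n + i + 1).choose s * ((n - i * s) * (n + i + 1 - s)) := by gcongr
      _ = ((n + i + 1).choose s * (n + i + 1 - s)) * (n - i * s) := by ring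
      _ = (n + i).choose s * (n - i * s) * (n + i + 1) := by rw [h1]; ring
      _ ≤ n.choose s * n * (n + i + 1) := by gcongr

lemma homogeneous_of_isCompleteUniform {V : Type*} [DecidableEq V] {k : ℕ} (hk : 1 < k)
    {H : Finset (Finset V)} (hH : IsCompleteUniform k H) :
    Homogeneous k H (fun U j => U.card = k * j) (fun j => (k * j - 1).choose (k - 1))
      (fun _ : V => ()) := by
  have hdeg : ∀ U j v, U.card = k * j → v ∈ U →
      (edgesAt H U v).card = (k * j - 1).choose (k - 1) := by
    intro U j v hU hv
    have h1 := edgesAt_filter_of_isCompleteUniform hH U v v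
    rw [filter_true_of_mem fun T hT => (mem_edgesAt.1 hT).2, pair_eq_singleton] at h1
    rw [h1, card_filter_powersetCard_subset _ _ _ (singleton_subset_iff.2 hv)
      (by rw [card_singleton]; omega), card_singleton, hU]
  have hcodeg : ∀ U j u v, U.card = k * j → u ∈ U → v ∈ U → u ≠ v →
      ((edgesAt H U u).filter (v ∈ ·)).card = (k * j - 2).choose (k - 2) := by
    intro U j u v hU hu hv huv
    rw [edgesAt_filter_of_isCompleteUniform hH, card_filter_powersetCard_subset _ _ _
      (insert_subset hu (singleton_subset_iff.2 hv)) (by rw [card_pair huv]; omega),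
      card_pair huv, hU]
  have hrel : ∀ j, 1 ≤ j → (k * j - 1) * (k * j - 2).choose (k - 2) =
      (k * j - 1).choose (k - 1) * (k - 1) := by
    intro j hj
    have hkj : k ≤ k * j := Nat.le_mul_of_pos_right _ hj
    have := Nat.add_one_mul_choose_eq (k * j - 2) (k - 2)
    rwa [show k * j - 2 + 1 = k * j - 1 by omega, show k - 2 + 1 = k - 1 by omega] at this
  refine
    { card_edge := fun S hS => (hH S).1 hS
      card_level := fun U j hU => hU
      level_sdiff := ?_
      degree := hdeg
      degree_pos := ?_
      degree_mono := fun j => Nat.choose_le_choose _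
        (Nat.sub_le_sub_right (Nat.mul_le_mul_left k (by omega)) 1)
      codegree := ?_
      swap := ?_
      bij := ?_
      invert := ?_ }
  · intro U j S hU hS
    rw [mem_edgesIn, hH S] at hS
    rw [card_sdiff_of_subset hS.2, hS.1, hU, mul_add, mul_one, Nat.add_sub_cancel]
  · intro j hj
    have hkj : k ≤ k * j := Nat.le_mul_of_pos_right _ hj
    exact Nat.choose_pos (by omega)
  · intro U j u v hU hu hv huv
    rw [hcodeg U j u v hU hu hv huv]
    have hj : 1 ≤ j := by
      by_contra hj
      have : j = 0 := by omega
      rw [this, mul_zero, card_eq_zero] at hU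
      simp [hU] at hu
    refine Nat.le_of_mul_le_mul_right ?_ (show 0 < k - 1 by omega)
    rw [← hrel j hj]
    have h1 : j * (k - 1) ≤ k * j - 1 := by
      rw [Nat.mul_sub, mul_one, mul_comm j k]
      omega
    calc j * (k * j - 2).choose (k - 2) * (k - 1)
        = j * (k - 1) * (k * j - 2).choose (k - 2) := by ring
      _ ≤ _ := Nat.mul_le_mul_right _ h1
  · intro S hS u hu v hv _
    rw [hH] at hS ⊢
    rw [card_insert_of_notMem (fun h => hv (mem_of_mem_erase h)), card_erase_of_mem hu, hS]
    omega
  · intro S hS T hT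
    have hcS := (hH S).1 hS
    have hcT := (hH T).1 hT
    obtain ⟨v, -⟩ : S.Nonempty := card_pos.1 (by omega)
    have : Nonempty V := ⟨v⟩
    obtain ⟨e, he⟩ := S.finite_toSet.exists_bijOn_of_encard_eq (t := (T : Set V))
      (by rw [Set.encard_coe_eq_coe_finsetCard, Set.encard_coe_eq_coe_finsetCard, hcS, hcT])
    exact ⟨e, he, fun _ _ => rfl⟩
  · intro U j hU hj
    have hk1 : (2 : ℝ) ≤ k := by exact_mod_cast hk
    have hj' : (4 : ℝ) * k ^ 2 ≤ j := by exact_mod_cast hj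
    have hj1 : 1 ≤ j := by nlinarith
    have hkj : k ≤ k * j := Nat.le_mul_of_pos_right _ hj1
    have hkj2 : 2 * k ≤ k * j := by
      rw [mul_comm]
      exact Nat.mul_le_mul_left k (by nlinarith)
    have hden : (0 : ℝ) < k * j - 1 := by nlinarith
    refine ⟨(k * j - 2).choose (k - 1), (k - 1) / (k * j - 1), ?_, ?_, ?_, ?_, ?_⟩
    · exact_mod_cast Nat.choose_pos (by omega)
    · exact div_nonneg (by linarith) hden.le
    · rw [div_mul_cancel₀ _ hden.ne']
    · have h1 := choose_add_mul_le (k * j - 2) (k - 1) (k + 1)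
      have e1 : k * j - 2 + (k + 1) = k * (j + 1) - 1 := by rw [mul_add]; omega
      have e2 : ((k * j - 2 : ℕ) : ℝ) = k * j - 2 := by
        rw [Nat.cast_sub (by omega)]; push_cast; ring
      have e3 : ((k - 1 : ℕ) : ℝ) = k - 1 := by rw [Nat.cast_sub (by omega)]; simp
      rw [e1, e2, e3] at h1
      push_cast at h1
      have hn : (0 : ℝ) < k * j - 2 := by nlinarith
      refine le_of_mul_le_mul_right ?_ hn
      have hc : (0 : ℝ) ≤ (k * (j + 1) - 1).choose (k - 1) := by positivity
      have h2 : (k : ℝ) * (k * j - 2) ≤ (k + 1) * (k * j - 2 - (k + 1) * (k - 1)) := by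
        nlinarith [mul_le_mul_of_nonneg_left hj' (show (0 : ℝ) ≤ k by linarith),
          pow_pos (show (0 : ℝ) < k by linarith) 3]
      calc (k : ℝ) * (k * (j + 1) - 1).choose (k - 1) * (k * j - 2)
          = (k * (j + 1) - 1).choose (k - 1) * (k * (k * j - 2)) := by ring
        _ ≤ (k * (j + 1) - 1).choose (k - 1) *
            ((k + 1) * (k * j - 2 - (k + 1) * (k - 1))) := by gcongr
        _ = (k + 1) * ((k * (j + 1) - 1).choose (k - 1) *
            (k * j - 2 - (k + 1) * (k - 1))) := by ring
        _ ≤ (k + 1) * ((k * j - 2).choose (k - 1) * (k * j - 2)) := by gcongr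
        _ = _ := by ring
    · intro q δ _ v hv
      rw [sum_edgesAt_sum, ← add_sum_erase U _ hv, ← add_sum_erase U δ hv]
      have e1 : ∑ u ∈ U.erase v, (((edgesAt H U v).filter (u ∈ ·)).card : ℝ) * δ u =
          (k * j - 2).choose (k - 2) * ∑ u ∈ U.erase v, δ u := by
        rw [mul_sum]
        refine Finset.sum_congr rfl fun u hu => ?_
        rw [mem_erase] at hu
        rw [hcodeg U j v u hU hv hu.2 hu.1.symm]
      have hpascal : (k * j - 1).choose (k - 1) =
          (k * j - 2).choose (k - 2) + (k * j - 2).choose (k - 1) := by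
        rw [show k * j - 1 = (k * j - 2) + 1 by omega, show k - 1 = (k - 2) + 1 by omega]
        exact Nat.choose_succ_succ _ _
      have hpascal' : ((k * j - 1).choose (k - 1) : ℝ) =
          (k * j - 2).choose (k - 2) + (k * j - 2).choose (k - 1) := by exact_mod_cast hpascal
      have hrel' : ((k : ℝ) * j - 1) * (k * j - 2).choose (k - 2) =
          (k * j - 1).choose (k - 1) * (k - 1) := by
        have := hrel j hj1
        have e4 : ((k * j - 1 : ℕ) : ℝ) = k * j - 1 := by
          rw [Nat.cast_sub (by omega)]; push_cast; ring
        have e3 : ((k - 1 : ℕ) : ℝ) = k - 1 := by rw [Nat.cast_sub (by omega)]; simp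
        rw [← e4, ← e3]
        exact_mod_cast this
      have hM2 : ((k * j - 1).choose (k - 1) : ℝ) * ((k - 1) / (k * j - 1)) =
          (k * j - 2).choose (k - 2) := by
        rw [← mul_div_assoc, ← hrel', mul_div_cancel_left₀ _ hden.ne']
      rw [filter_true_of_mem fun T hT => (mem_edgesAt.1 hT).2, hdeg U j v hU hv, e1,
        ← mul_assoc, hM2, hpascal']
      ring

/-! ### Complete partite hypergraphs are homogeneous -/

section

variable {V : Type*} {k : ℕ} {H : Finset (Finset V)} {r : V → Fin k}

/-- Number of transversals of the classes of `r` with prescribed sets `A i` of admissible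
vertices in each class. -/
lemma card_transversals [DecidableEq V] (hH : ∀ S, S ∈ H ↔ ∀ i, (S.filter (r · = i)).card = 1)
    (A : Fin k → Finset V) (hA : ∀ i, ∀ v ∈ A i, r v = i) :
    (H.filter fun T => ∀ v ∈ T, v ∈ A (r v)).card = ∏ i, (A i).card := by
  rw [← Fintype.card_piFinset]
  symm
  refine Finset.card_bij (fun f _ => univ.image f) ?_ ?_ ?_
  · intro f hf
    rw [Fintype.mem_piFinset] at hf
    have hr : ∀ i, r (f i) = i := fun i => hA i _ (hf i)
    rw [mem_filter, hH]
    refine ⟨fun i => card_eq_one.2 ⟨f i, ?_⟩, ?_⟩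
    · ext x
      simp only [mem_filter, mem_image, mem_univ, true_and, mem_singleton]
      constructor
      · rintro ⟨⟨i', rfl⟩, h⟩
        rw [hr] at h
        rw [h]
      · rintro rfl
        exact ⟨⟨i, rfl⟩, hr i⟩
    · intro v hv
      obtain ⟨i, -, rfl⟩ := mem_image.1 hv
      rw [hr]
      exact hf i
  · intro f hf g hg hfg
    rw [Fintype.mem_piFinset] at hf hg
    ext i
    have : f i ∈ univ.image g := hfg ▸ mem_image_of_mem f (mem_univ i)
    obtain ⟨i', -, h⟩ := mem_image.1 this
    have h2 : i' = i := by
      rw [← hA i' _ (hg i'), h, hA i _ (hf i)]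
    rw [← h, h2]
  · intro T hT
    rw [mem_filter, hH] at hT
    choose f hf using fun i => card_eq_one.1 (hT.1 i)
    have hfT : ∀ i, f i ∈ T ∧ r (f i) = i := by
      intro i
      have : f i ∈ T.filter (r · = i) := by
        rw [hf i]
        exact mem_singleton_self _
      exact mem_filter.1 this
    refine ⟨f, ?_, ?_⟩
    · rw [Fintype.mem_piFinset]
      intro i
      have := hT.2 _ (hfT i).1
      rwa [(hfT i).2] at this
    · ext x
      rw [mem_image]
      constructor
      · rintro ⟨i, -, rfl⟩
        exact (hfT i).1
      · intro hx
        refine ⟨r x, mem_univ _, ?_⟩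
        have : x ∈ T.filter (r · = r x) := mem_filter.2 ⟨hx, rfl⟩
        rw [hf, mem_singleton] at this
        exact this.symm

/-- An edge has only one vertex in each class. -/
lemma eq_of_mem_edge (hH : ∀ S, S ∈ H ↔ ∀ i, (S.filter (r · = i)).card = 1) {S : Finset V}
    (hS : S ∈ H) {u v : V} (hu : u ∈ S) (hv : v ∈ S) (h : r u = r v) : u = v :=
  Finset.card_le_one.1 ((hH S).1 hS (r v)).le u (mem_filter.2 ⟨hu, h⟩) v (mem_filter.2 ⟨hv, rfl⟩)

lemma exists_mem_edge (hH : ∀ S, S ∈ H ↔ ∀ i, (S.filter (r · = i)).card = 1) {S : Finset V}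
    (hS : S ∈ H) (i : Fin k) : ∃ v ∈ S, r v = i := by
  have : 0 < (S.filter (r · = i)).card := by rw [(hH S).1 hS i]; exact one_pos
  obtain ⟨v, hv⟩ := card_pos.1 this
  exact ⟨v, (mem_filter.1 hv).1, (mem_filter.1 hv).2⟩

lemma card_eq_sum_classes (S : Finset V) : S.card = ∑ i, (S.filter (r · = i)).card :=
  card_eq_sum_card_fiberwise fun _ _ => mem_univ _

/-- Two vertices that are equal or in different classes have codegree a power of `j`. -/
lemma card_edgesAt_filter [DecidableEq V] (hH : ∀ S, S ∈ H ↔ ∀ i, (S.filter (r · = i)).card = 1)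
    {U : Finset V} {j : ℕ} (hU : ∀ i, (U.filter (r · = i)).card = j) {u v : V} (hu : u ∈ U)
    (hv : v ∈ U) (huv : r u = r v → u = v) :
    ((edgesAt H U u).filter (v ∈ ·)).card = j ^ (k - ({r u, r v} : Finset (Fin k)).card) := by
  let A : Fin k → Finset V := fun i =>
    if i = r u then {u} else if i = r v then {v} else U.filter (r · = i)
  have hAr : ∀ i, ∀ x ∈ A i, r x = i := by
    intro i x hx
    simp only [A] at hx
    split_ifs at hx with h1 h2
    · rw [mem_singleton.1 hx, h1]
    · rw [mem_singleton.1 hx, h2]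
    · exact (mem_filter.1 hx).2
  have h1 : (edgesAt H U u).filter (v ∈ ·) = H.filter fun T => ∀ x ∈ T, x ∈ A (r x) := by
    ext T
    rw [mem_filter, mem_edgesAt, mem_filter]
    constructor
    · rintro ⟨⟨⟨hT, hTU⟩, huT⟩, hvT⟩
      refine ⟨hT, fun x hx => ?_⟩
      simp only [A]
      split_ifs with h2 h3
      · exact mem_singleton.2 (eq_of_mem_edge hH hT hx huT h2)
      · exact mem_singleton.2 (eq_of_mem_edge hH hT hx hvT h3)
      · exact mem_filter.2 ⟨hTU hx, rfl⟩
    · rintro ⟨hT, hTA⟩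
      have huT : u ∈ T := by
        obtain ⟨x, hx, hxu⟩ := exists_mem_edge hH hT (r u)
        have := hTA x hx
        simp only [A, hxu, if_true, mem_singleton] at this
        rwa [← this]
      have hvT : v ∈ T := by
        obtain ⟨x, hx, hxv⟩ := exists_mem_edge hH hT (r v)
        have := hTA x hx
        simp only [A, hxv, if_true] at this
        split_ifs at this with h2
        · rwa [← huv h2.symm]
        · rwa [← mem_singleton.1 this]
      refine ⟨⟨⟨hT, fun x hx => ?_⟩, huT⟩, hvT⟩
      have := hTA x hx
      simp only [A] at this
      split_ifs at this with h2 h3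
      · rwa [mem_singleton.1 this]
      · rwa [mem_singleton.1 this]
      · exact (mem_filter.1 this).1
  have h2 : ∀ i, (A i).card = if i ∈ ({r u, r v} : Finset (Fin k)) then 1 else j := by
    intro i
    simp only [A, mem_insert, mem_singleton]
    by_cases h2 : i = r u
    · simp [h2]
    · by_cases h3 : i = r v
      · simp only [h3, or_true, if_true]
        split_ifs <;> simp
      · simp [h2, h3, hU i]
  rw [h1, card_transversals hH A hAr, Finset.prod_congr rfl fun i _ => h2 i, prod_ite]
  simp only [prod_const_one, one_mul, prod_const]
  congr 1
  rw [filter_not, card_sdiff_of_subset (filter_subset _ _), filter_mem_eq_inter, univ_inter]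
  simp

lemma homogeneous_of_transversals [DecidableEq V] (hk : 1 < k)
    (hH : ∀ S, S ∈ H ↔ ∀ i, (S.filter (r · = i)).card = 1) :
    Homogeneous k H (fun U j => ∀ i, (U.filter (r · = i)).card = j) (fun j => j ^ (k - 1)) r := by
  have hcard : ∀ S ∈ H, S.card = k := by
    intro S hS
    rw [card_eq_sum_classes (r := r), Finset.sum_congr rfl fun i _ => (hH S).1 hS i]
    simp
  have hdeg : ∀ (U : Finset V) j v, (∀ i, (U.filter (r · = i)).card = j) → v ∈ U →
      (edgesAt H U v).card = j ^ (k - 1) := by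
    intro U j v hU hv
    have := card_edgesAt_filter hH hU hv hv fun _ => rfl
    rwa [filter_true_of_mem fun T hT => (mem_edgesAt.1 hT).2, pair_eq_singleton,
      card_singleton] at this
  have hcodeg : ∀ (U : Finset V) j u v, (∀ i, (U.filter (r · = i)).card = j) → u ∈ U → v ∈ U →
      u ≠ v → ((edgesAt H U u).filter (v ∈ ·)).card = if r v = r u then 0 else j ^ (k - 2) := by
    intro U j u v hU hu hv huv
    split_ifs with h
    · rw [card_eq_zero, filter_eq_empty_iff]
      intro T hT hvT
      rw [mem_edgesAt] at hT
      exact huv (eq_of_mem_edge hH hT.1.1 hT.2 hvT h.symm)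
    · rw [card_edgesAt_filter hH hU hu hv fun h' => absurd h'.symm h, card_pair (Ne.symm h)]
  have hpow : ∀ j : ℕ, j * j ^ (k - 2) = j ^ (k - 1) := by
    intro j
    rw [← pow_succ']
    congr 1
    omega
  refine
    { card_edge := hcard
      card_level := ?_
      level_sdiff := ?_
      degree := hdeg
      degree_pos := fun j hj => pow_pos hj _
      degree_mono := fun j => Nat.pow_le_pow_left (by omega) _
      codegree := ?_
      swap := ?_
      bij := ?_
      invert := ?_ }
  · intro U j hU
    rw [card_eq_sum_classes (r := r), Finset.sum_congr rfl fun i _ => hU i]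
    simp
  · intro U j S hU hS i
    rw [mem_edgesIn] at hS
    have h1 : (U \ S).filter (r · = i) = U.filter (r · = i) \ S.filter (r · = i) := by
      ext x
      simp only [mem_filter, mem_sdiff]
      tauto
    rw [h1, card_sdiff_of_subset (filter_subset_filter _ hS.2), hU, (hH S).1 hS.1,
      Nat.add_sub_cancel]
  · intro U j u v hU hu hv huv
    rw [hcodeg U j u v hU hu hv huv]
    split_ifs
    · simp
    · rw [hpow]
  · intro S hS u hu v hv huv
    rw [hH] at hS ⊢
    intro i
    rw [filter_insert, filter_erase]
    split_ifs with h
    · have hu' : u ∈ S.filter (r · = i) := mem_filter.2 ⟨hu, huv.trans h⟩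
      rw [card_insert_of_notMem fun h => hv (mem_filter.1 (mem_of_mem_erase h)).1,
        card_erase_of_mem hu', hS]
    · have hu' : u ∉ S.filter (r · = i) := fun h' => h (huv.symm.trans (mem_filter.1 h').2)
      rw [erase_eq_of_notMem hu', hS]
  · intro S hS T hT
    choose f hf using exists_mem_edge hH hT
    refine ⟨fun v => f (r v), ⟨fun v _ => (hf (r v)).1, ?_, ?_⟩, fun v _ => (hf (r v)).2⟩
    · intro u hu v hv huv
      refine eq_of_mem_edge hH hS hu hv ?_
      rw [← (hf (r u)).2, ← (hf (r v)).2]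
      exact congrArg r huv
    · intro t ht
      obtain ⟨v, hv, hvt⟩ := exists_mem_edge hH hS (r t)
      exact ⟨v, hv, eq_of_mem_edge hH hT (hf _).1 ht ((hf _).2.trans hvt)⟩
  · intro U j hU hj
    have hk1 : (2 : ℝ) ≤ k := by exact_mod_cast hk
    have hj' : (4 : ℝ) * k ^ 2 ≤ j := by exact_mod_cast hj
    have hj1 : 1 ≤ j := by nlinarith
    have hj0 : (0 : ℝ) < j := by exact_mod_cast hj1
    have hk0 : (0 : ℝ) < k := by linarith
    refine ⟨(j : ℝ) ^ (k - 1), (k - 1) / (k * j), by positivity,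
      div_nonneg (by linarith) (by positivity), ?_, ?_, ?_⟩
    · rw [div_mul_eq_mul_div, div_le_iff₀ (by positivity)]
      nlinarith
    · -- Bernoulli's inequality for `(1 - 1 / (j + 1)) ^ (k - 1)`
      have hb := one_add_mul_le_pow (a := -(1 / ((j : ℝ) + 1))) (by
        have : 1 / ((j : ℝ) + 1) ≤ 1 := by
          rw [div_le_one (by positivity)]
          linarith
        linarith) (k - 1)
      have e3 : ((k - 1 : ℕ) : ℝ) = k - 1 := by rw [Nat.cast_sub (by omega)]; simp
      have e4 : 1 + -(1 / ((j : ℝ) + 1)) = j / (j + 1) := by field_simp; ring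
      rw [e3, e4, div_pow, le_div_iff₀ (by positivity)] at hb
      have h1 : (k : ℝ) ≤ (k + 1) * (1 + (k - 1) * -(1 / ((j : ℝ) + 1))) := by
        have : ((k : ℝ) + 1) * (k - 1) * (1 / (j + 1)) ≤ 1 := by
          rw [mul_one_div, div_le_one (by positivity)]
          nlinarith
        linarith
      push_cast
      calc (k : ℝ) * (j + 1) ^ (k - 1)
          ≤ (k + 1) * (1 + (k - 1) * -(1 / ((j : ℝ) + 1))) * (j + 1) ^ (k - 1) := by gcongr
        _ = (k + 1) * ((1 + (k - 1) * -(1 / ((j : ℝ) + 1))) * (j + 1) ^ (k - 1)) := by ring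
        _ ≤ _ := by gcongr
    · intro q δ hδ v hv
      -- vertex sums of an edge weight have the same total on every class
      have hclass : ∀ i, ∑ u ∈ U with r u = i, δ u = ∑ T ∈ edgesIn H U, q T := by
        intro i
        have := sum_sum_edgesAt H U q (fun u => if r u = i then 1 else 0)
        simp only [ite_mul, one_mul, zero_mul] at this
        rw [← sum_filter] at this
        rw [Finset.sum_congr rfl fun u hu => hδ u (mem_filter.1 hu).1, this]
        refine Finset.sum_congr rfl fun T hT => ?_
        rw [← sum_filter, sum_const, (hH T).1 (mem_edgesIn.1 hT).1]
        simp
      have hD : ∑ u ∈ U, δ u = k * ∑ T ∈ edgesIn H U, q T := by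
        rw [← sum_fiberwise_of_maps_to (g := r) (t := univ) fun _ _ => mem_univ _,
          Finset.sum_congr rfl fun i _ => hclass i]
        simp
      have hsplit := sum_filter_add_sum_filter_not U (fun u => r u = r v) δ
      rw [hclass, hD] at hsplit
      have hterm : ∀ u ∈ U, (((edgesAt H U v).filter (u ∈ ·)).card : ℝ) * δ u =
          (if u = v then (j : ℝ) ^ (k - 1) * δ u else 0) +
            (if ¬ r u = r v then (j : ℝ) ^ (k - 2) * δ u else 0) := by
        intro u hu
        by_cases huv : u = v
        · subst huv
          rw [filter_true_of_mem fun T hT => (mem_edgesAt.1 hT).2, hdeg U j u hU hu]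
          simp
        · rw [hcodeg U j v u hU hv hu (Ne.symm huv)]
          by_cases h : r u = r v <;> simp [h, huv]
      rw [sum_edgesAt_sum, Finset.sum_congr rfl hterm, sum_add_distrib, sum_ite_eq' U v, if_pos hv,
        ← sum_filter, ← mul_sum, hD]
      have e5 : (j : ℝ) * (j : ℝ) ^ (k - 2) = (j : ℝ) ^ (k - 1) := by exact_mod_cast hpow j
      have e6 : ∑ u ∈ U with ¬ r u = r v, δ u = (k - 1) * ∑ T ∈ edgesIn H U, q T := by linarith
      rw [e6]
      push_cast
      rw [← e5]
      field_simp

end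

/-- The homogeneous structure of a complete partite hypergraph, with the whole vertex set at
level `m`. -/
lemma exists_homogeneous_of_isCompletePartite {V : Type*} [Fintype V] [DecidableEq V] {k m : ℕ}
    (hk : 1 < k) {H : Finset (Finset V)} (hH : IsCompletePartite k m H) :
    ∃ (Lev : Finset V → ℕ → Prop) (M : ℕ → ℕ) (r : V → Fin k),
      Homogeneous k H Lev M r ∧ Lev univ m := by
  obtain ⟨part, hdisj, hcov, hcard, hedge⟩ := hH
  choose r hr using hcov
  have hpart : ∀ v i, v ∈ part i ↔ r v = i := by
    intro v i
    constructor
    · intro hv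
      by_contra hne
      exact Finset.disjoint_left.1 (hdisj _ _ hne) (hr v) hv
    · rintro rfl
      exact hr v
  have hfilter : ∀ (S : Finset V) i, S.filter (r · = i) = S ∩ part i := by
    intro S i
    ext v
    rw [mem_filter, mem_inter, hpart]
  refine ⟨_, _, r, homogeneous_of_transversals hk fun S => ?_, fun i => ?_⟩
  · rw [hedge]
    simp_rw [hfilter]
  · rw [hfilter, univ_inter, hcard]

/-! ### Bounds for the partition function -/

/-- A stochastic weight is scaled by the multipliers `1`. -/
lemma isScaling_one {V : Type*} [Fintype V] [DecidableEq V] {H : Finset (Finset V)}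
    {Z : Finset V → ℝ} (hZ : IsStochastic H Z) : IsScaling H Z univ (fun _ => 1) where
  pos _ _ := one_pos
  sum_eq_one v _ := by
    refine Eq.trans ?_ (hZ v)
    refine Finset.sum_congr ?_ fun S _ => by simp [scaled]
    ext S
    simp [mem_edgesAt]

lemma partitionFunction_bounds {V : Type*} [Fintype V] [DecidableEq V] {k : ℕ} (hk : 1 < k)
    {α : ℝ} (hα : 1 ≤ α) (hα2 : 2 < α ^ (k + 1)) {m : ℕ} {H : Finset (Finset V)}
    {Z : Finset V → ℝ} (hm : 1 < m) (hV : Fintype.card V = k * m)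
    (hH : IsCompleteUniform k H ∨ IsCompletePartite k m H)
    (hZ : IsStochastic H Z) (hb : IsBalanced α H Z) :
    epsLower k α * (m : ℝ) ^ (-gammaLower k α) * Real.exp (-((m : ℝ) * ((k : ℝ) - 1))) ≤
        partitionFunction H Z ∧
      partitionFunction H Z ≤ epsUpper k α * (m : ℝ) ^ gammaUpper k α *
        Real.exp (-((m : ℝ) * ((k : ℝ) - 1))) := by
  have hone : scaled Z (fun _ => 1) = Z := by
    ext S
    simp [scaled]
  have hsc := isScaling_one hZ
  rw [partitionFunction_eq_matchSum]
  rcases hH with hH | hH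
  · have h := homogeneous_of_isCompleteUniform hk hH
    have h1 := h.epsLower_le_matchSum hk hα hα2 hb hm (U := univ) hV hsc
    have h2 := h.matchSum_le_epsUpper hk hα hb hm (U := univ) hV hsc
    rw [hone] at h1 h2
    exact ⟨h1, h2⟩
  · obtain ⟨Lev, M, r, h, hlev⟩ := exists_homogeneous_of_isCompletePartite hk hH
    have h1 := h.epsLower_le_matchSum hk hα hα2 hb hm hlev hsc
    have h2 := h.matchSum_le_epsUpper hk hα hb hm hlev hsc
    rw [hone] at h1 h2
    exact ⟨h1, h2⟩

lemma IsBalanced.mono {V : Type*} {α α' : ℝ} (h : α ≤ α') {H : Finset (Finset V)}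
    {w : Finset V → ℝ} (hw : IsBalanced α H w) : IsBalanced α' H w :=
  ⟨hw.1, fun S hS T hT => (hw.2 S hS T hT).trans h⟩

/-- A positive constant is absorbed by a power of an integer greater than `1`. -/
lemma absorb_const_rpow {m : ℕ} (hm : 1 < m) {ε g : ℝ} (hε : 0 < ε) :
    ε * (m : ℝ) ^ g ≤ (m : ℝ) ^ (g + |Real.log ε| / Real.log 2) ∧
      (m : ℝ) ^ (g - |Real.log ε| / Real.log 2) ≤ ε * (m : ℝ) ^ g := by
  have hm2 : (2 : ℝ) ≤ m := by exact_mod_cast hm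
  have hm0 : (0 : ℝ) < m := by linarith
  have hl2 : 0 < Real.log 2 := Real.log_pos (by norm_num)
  have hlm : Real.log 2 ≤ Real.log m := Real.log_le_log (by norm_num) hm2
  have h1 : |Real.log ε| ≤ Real.log m * (|Real.log ε| / Real.log 2) := by
    rw [mul_div_assoc', le_div_iff₀ hl2, mul_comm]
    gcongr
  have e : ε * (m : ℝ) ^ g = Real.exp (Real.log ε + Real.log m * g) := by
    rw [Real.exp_add, Real.exp_log hε, Real.rpow_def_of_pos hm0]
  rw [e, Real.rpow_def_of_pos hm0, Real.rpow_def_of_pos hm0, Real.exp_le_exp, Real.exp_le_exp]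
  constructor
  · linarith [le_abs_self (Real.log ε)]
  · linarith [neg_abs_le (Real.log ε)]

end HypergraphMatching

theorem theorem1p3 (k : ℕ) (hk : 1 < k) (α : ℝ) (hα : 1 ≤ α) :
    (∃ γ : ℝ, 0 < γ ∧
      ∀ (V : Type u) [Fintype V] [DecidableEq V] (m : ℕ) (H : Finset (Finset V))
        (Z : Finset V → ℝ),
        1 < m → Fintype.card V = k * m →
        (HypergraphMatching.IsCompleteUniform k H ∨
          HypergraphMatching.IsCompletePartite k m H) →
        HypergraphMatching.IsStochastic H Z → HypergraphMatching.IsBalanced α H Z →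
        (m : ℝ) ^ (-γ) * Real.exp (-((m : ℝ) * ((k : ℝ) - 1))) ≤
            HypergraphMatching.partitionFunction H Z ∧
          HypergraphMatching.partitionFunction H Z ≤
            (m : ℝ) ^ γ * Real.exp (-((m : ℝ) * ((k : ℝ) - 1)))) ∧
    (2 < α ^ (k + 1) →
      ∀ (V : Type u) [Fintype V] [DecidableEq V] (m : ℕ) (H : Finset (Finset V))
        (Z : Finset V → ℝ),
        1 < m → Fintype.card V = k * m →
        (HypergraphMatching.IsCompleteUniform k H ∨
          HypergraphMatching.IsCompletePartite k m H) →
        HypergraphMatching.IsStochastic H Z → HypergraphMatching.IsBalanced α H Z →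
        HypergraphMatching.epsLower k α * (m : ℝ) ^ (-HypergraphMatching.gammaLower k α) *
              Real.exp (-((m : ℝ) * ((k : ℝ) - 1))) ≤
            HypergraphMatching.partitionFunction H Z ∧
          HypergraphMatching.partitionFunction H Z ≤
            HypergraphMatching.epsUpper k α * (m : ℝ) ^ HypergraphMatching.gammaUpper k α *
              Real.exp (-((m : ℝ) * ((k : ℝ) - 1)))) := by
  refine ⟨?_, fun hα2 V _ _ m H Z hm hV hH hZ hb =>
    HypergraphMatching.partitionFunction_bounds hk hα hα2 hm hV hH hZ hb⟩
  -- the first part follows from the second with `α` replaced by the weaker constant `a`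
  set a := max α 2
  have ha : 1 ≤ a := hα.trans (le_max_left _ _)
  have ha2 : (2 : ℝ) < a ^ (k + 1) := by
    have h2 : (2 : ℝ) ≤ a := le_max_right _ _
    calc (2 : ℝ) < 2 ^ 2 := by norm_num
      _ ≤ a ^ 2 := by gcongr
      _ ≤ a ^ (k + 1) := pow_le_pow_right₀ ha (by omega)
  have he1 : 0 < HypergraphMatching.epsLower k a := by
    rw [HypergraphMatching.epsLower_eq hk ha rfl]
    have hA : 0 < (k * (⌈a ^ (2 * (k + 1)) * (k : ℝ) ^ 2⌉₊ + 1) - 1).choose (k - 1) :=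
      Nat.choose_pos (Nat.sub_le_sub_right (Nat.le_mul_of_pos_right _ (by omega)) 1)
    positivity
  have he2 : 0 < HypergraphMatching.epsUpper k a := Real.exp_pos _
  set g1 := HypergraphMatching.gammaLower k a +
    |Real.log (HypergraphMatching.epsLower k a)| / Real.log 2 with hg1
  set g2 := HypergraphMatching.gammaUpper k a +
    |Real.log (HypergraphMatching.epsUpper k a)| / Real.log 2 with hg2
  refine ⟨max (max g1 g2) 1, lt_max_of_lt_right one_pos, fun V _ _ m H Z hm hV hH hZ hb => ?_⟩
  have hm1 : (1 : ℝ) ≤ m := by exact_mod_cast hm.le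
  obtain ⟨h1, h2⟩ := HypergraphMatching.partitionFunction_bounds hk ha ha2 hm hV hH hZ
    (hb.mono (le_max_left _ _))
  constructor
  · refine le_trans (mul_le_mul_of_nonneg_right ?_ (Real.exp_pos _).le) h1
    refine le_trans (Real.rpow_le_rpow_of_exponent_le hm1 ?_)
      (HypergraphMatching.absorb_const_rpow hm he1).2
    have : g1 ≤ max (max g1 g2) 1 := (le_max_left _ _).trans (le_max_left _ _)
    linarith
  · refine h2.trans (mul_le_mul_of_nonneg_right ?_ (Real.exp_pos _).le)
    refine le_trans (HypergraphMatching.absorb_const_rpow hm he2).1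
      (Real.rpow_le_rpow_of_exponent_le hm1 ?_)
    exact (le_max_right _ _).trans (le_max_left _ _)
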